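/- Setting. Let $\Gamma$ be an oriented multigraph (loops and multiple edges allowed) with vertex set $V$ and edge set $E$. For $v\in V$ let $E_v^-$ and $E_v^+$ be the sets of edges that start, respectively end, at $v$; the degree of $v$ is the cardinal of $E_v^-\cup E_v^+$. To each $v$ attach a Riemann sphere $S_v=\mathbb C\cup\{\infty\}$ with standard coordinate $z$, and to each edge $e$ from $v$ to $v'$ attach points $p_e^-\in S_v$, $p_e^+\in S_{v'}$ different from $\infty$ and local complex coordinates (biholomorphic maps) $z_e^\pm:D_e^\pm\to D(0,\rho)$, $z_e^\pm(p_e^\pm)=0$, where on each sphere the disks $D_e^-$ ($e\in E_v^-$) and $D_e^+$ ($e\in E_v^+$) are pairwise disjoint. Assume that the coordinates are admissible: $c_1|z_e^\pm(z)|\le|z-p_e^\pm|\le c_2|z_e^\pm(z)|$ on $D_e^\pm$ for all $e$, where $\rho,c_1,c_2>0$ do not depend on $e$. Given $\mathbf t=(t_e)_{e\in E}$ with $|t_e|<\rho^2$, let $\Sigma_{\mathbf t}$ be the (possibly noded) Riemann surface obtained as follows for each $e$: if $t_e\ne0$, remove the disks $|z_e^\pm|\le|t_e|/\rho$ and identify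 $z\in D_e^-$ with $z'\in D_e^+$ when $z_e^-(z)\,z_e^+(z')=t_e$; if $t_e=0$, identify $p_e^-$ with $p_e^+$. A regular differential on $\Sigma_{\mathbf t}$ is a differential that is holomorphic away from the nodes and has at most simple poles, with opposite residues, at the two points of each node. Let $\gamma_e$ be the homology class of $\partial D_e^+$. For a fixed $\epsilon\in(0,\rho c_1]$ let $\mathcal H^1_\infty(\Sigma_{\mathbf t})$ be the space of regular differentials $\omega$ for which $|\omega/dz|$ is bounded, uniformly in $v$, on $S_v$ minus the disks of radius $\epsilon$ centered at the points $p_e^-$ ($e\in E_v^-$) and $p_e^+$ ($e\in E_v^+$). Statement. Assume that the degrees of all vertices are at most $k$. There exist constants $C>0$ and $\delta>0$, depending only on $\rho$, $c_1$, $c_2$ and $k$, such that if $\sup_e|t_e|\le\delta$, then for every $\omega\in\mathcal H^1_\infty(\Sigma_{\mathbf t})$ whose period vector $\alpha=(\alpha_e)_{e\in E}$, $\alpha_e=\int_{\gamma_e}\omega$, is bounded, and for every edge $e\in E$, one has $$\left|\frac{\omega}{dz}-\frac{1}{2\pi i}\,\frac{\alpha_e}{z-p_e^+}\right|\le C\|\alpha\|_\infty\quad\text{in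 the annulus } |t_e|^{1/2}\le|z_e^+|\le\rho,$$ $$\left|\frac{\omega}{dz}+\frac{1}{2\pi i}\,\frac{\alpha_e}{z-p_e^-}\right|\le C\|\alpha\|_\infty\quad\text{in the annulus } |t_e|^{1/2}\le|z_e^-|\le\rho.$$ (The set $|z_e^\pm|=\rho$ is understood as the boundary of $D_e^\pm$, and when $t_e=0$ the point $p_e^\pm$ itself is excluded.) -/

import Mathlib

open Set Filter Topology

noncomputable section

namespace OpeningNodes

/-- An oriented multigraph with vertex set `V` and edge set `E` (multiple edges and loops allowed):
the edge `e` goes from `src e` to `tgt e`. -/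
structure OrientedMultigraph (V E : Type*) where
  src : E → V
  tgt : E → V

/-- The two ends of the edges: `(e, false)` is the starting end of `e` (exponent `-`), which lies on
the sphere of the vertex `src e`, and `(e, true)` is the final end of `e` (exponent `+`), which lies
on the sphere of `tgt e`. -/
abbrev EdgeEnd (E : Type*) := E × Bool

variable {V E : Type*}

namespace OrientedMultigraph

/-- The vertex at which an end of an edge is attached. -/
def vertexOf (G : OrientedMultigraph V E) (h : EdgeEnd E) : V :=
  if h.2 = true then G.tgt h.1 else G.src h.1

/-- `E_v`, the set of edges adjacent to `v`. -/
def edgesAt (G : OrientedMultigraph V E) (v : V) : Set E := {e | G.src e = v ∨ G.tgt e = v}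

/-- Every vertex has degree at most `k`. -/
def DegreeLE (G : OrientedMultigraph V E) (k : ℕ) : Prop :=
  ∀ v, (G.edgesAt v).encard ≤ k

end OrientedMultigraph

/-- Points `p_e^±` and admissible local complex coordinates `z_e^± : D_e^± → D(0, ρ)`.
The disk `D_e^±` is the source of `coord (e, ±)`. The points are finite, and so are the points of the
disks, because of `upper`; hence the disks are subsets of `ℂ`. -/
structure AdmissibleCoordinates (G : OrientedMultigraph V E) (ρ c₁ c₂ : ℝ) where
  p : EdgeEnd E → ℂ
  coord : EdgeEnd E → OpenPartialHomeomorph ℂ ℂ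
  target_eq : ∀ h, (coord h).target = Metric.ball 0 ρ
  holo : ∀ h, DifferentiableOn ℂ (coord h) (coord h).source
  p_mem : ∀ h, p h ∈ (coord h).source
  coord_p : ∀ h, coord h (p h) = 0
  disjoint : ∀ h h', h ≠ h' → G.vertexOf h = G.vertexOf h' →
    Disjoint (coord h).source (coord h').source
  lower : ∀ h, ∀ z ∈ (coord h).source, c₁ * ‖coord h z‖ ≤ ‖z - p h‖
  upper : ∀ h, ∀ z ∈ (coord h).source, ‖z - p h‖ ≤ c₂ * ‖coord h z‖

namespace AdmissibleCoordinates

variable {G : OrientedMultigraph V E} {ρ c₁ c₂ : ℝ}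

/-- The topological disk `D_e^±`. -/
def disk (N : AdmissibleCoordinates G ρ c₁ c₂) (h : EdgeEnd E) : Set ℂ := (N.coord h).source

/-- What is removed from the disk `D_e^±`: the closed disk `|z_e^±| ≤ |t_e| / ρ`
(only the point `p_e^±` if `t_e = 0`). -/
def removed (N : AdmissibleCoordinates G ρ c₁ c₂) (t : E → ℂ) (h : EdgeEnd E) : Set ℂ :=
  {z | z ∈ N.disk h ∧ ‖N.coord h z‖ ≤ ‖t h.1‖ / ρ}

/-- The finite points of the sphere `S_v` that remain in `Σ_t`, nodes excluded. -/
def sphereDomain (N : AdmissibleCoordinates G ρ c₁ c₂) (t : E → ℂ) (v : V) : Set ℂ :=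
  {z | ∀ h, G.vertexOf h = v → z ∉ N.removed t h}

/-- The identification `φ_e^+ = (z_e^+)⁻¹ ∘ (t_e / z_e^-)` of the annulus
`|t_e| / ρ < |z_e^-| < ρ` with the annulus `|t_e| / ρ < |z_e^+| < ρ`. -/
def gluing (N : AdmissibleCoordinates G ρ c₁ c₂) (t : E → ℂ) (e : E) (z : ℂ) : ℂ :=
  (N.coord (e, true)).symm (t e / N.coord (e, false) z)

/-- The finite points of `Ω_{v,ε}`: the sphere `S_v` minus the round disks `D(p_e^±, ε)`. -/
def Omega (N : AdmissibleCoordinates G ρ c₁ c₂) (ε : ℝ) (v : V) : Set ℂ :=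
  {z | ∀ h, G.vertexOf h = v → z ∉ Metric.ball (N.p h) ε}

/-- The annulus `|t_e|^{1/2} ≤ |z_e^±| ≤ ρ` on the sphere, the boundary of `D_e^±` playing the role
of `|z_e^±| = ρ`; the node `p_e^±` is not included when `t_e = 0`. -/
def neckAnnulus (N : AdmissibleCoordinates G ρ c₁ c₂) (t : E → ℂ) (h : EdgeEnd E) : Set ℂ :=
  {z | z ∈ closure (N.disk h) ∧ z ≠ N.p h ∧ (z ∈ N.disk h → √‖t h.1‖ ≤ ‖N.coord h z‖)}

end AdmissibleCoordinates

/-- A differential `f(z) dz` is holomorphic at `∞`: in the coordinate `w = 1/z` it is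
`-f(1/w) / w² dw`, and this coefficient extends holomorphically to `w = 0`. -/
def HolomorphicAtInfty (f : ℂ → ℂ) : Prop :=
  ∃ g : ℂ → ℂ, AnalyticAt ℂ g 0 ∧ ∀ᶠ w in 𝓝[≠] (0 : ℂ), g w = -f w⁻¹ / w ^ 2

/-- The differential `f(z) dz` has at most a simple pole at `p`, with residue `a`. -/
def SimplePoleWithResidue (f : ℂ → ℂ) (p a : ℂ) : Prop :=
  ∃ g : ℂ → ℂ, AnalyticAt ℂ g p ∧ ∀ᶠ z in 𝓝[≠] p, f z = a / (z - p) + g z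

/-- A regular differential `ω` on the (possibly noded) Riemann surface `Σ_t` obtained by opening
nodes, written in the coordinate `z` of each sphere: on `S_v` it is `toFun v z dz`
(only the values at points of `Σ_t` are meaningful). It is holomorphic on what remains of each
sphere (`∞` included), it agrees with its pull-back under the identification on each neck, and at
each node it has at most simple poles with opposite residues. -/
structure RegularDifferential {G : OrientedMultigraph V E} {ρ c₁ c₂ : ℝ}
    (N : AdmissibleCoordinates G ρ c₁ c₂) (t : E → ℂ) where
  toFun : V → ℂ → ℂ
  holo : ∀ v, DifferentiableOn ℂ (toFun v) (N.sphereDomain t v)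
  holo_infty : ∀ v, HolomorphicAtInfty (toFun v)
  neck : ∀ e, t e ≠ 0 → ∀ z ∈ N.disk (e, false), ‖t e‖ / ρ < ‖N.coord (e, false) z‖ →
    toFun (G.src e) z = toFun (G.tgt e) (N.gluing t e z) * deriv (N.gluing t e) z
  node : ∀ e, t e = 0 → ∃ a : ℂ,
    SimplePoleWithResidue (toFun (G.tgt e)) (N.p (e, true)) a ∧
    SimplePoleWithResidue (toFun (G.src e)) (N.p (e, false)) (-a)

namespace RegularDifferential

variable {G : OrientedMultigraph V E} {ρ c₁ c₂ : ℝ}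
  {N : AdmissibleCoordinates G ρ c₁ c₂} {t : E → ℂ}

/-- The period `∫_{γ_e} ω`, where `γ_e` is the homology class of `∂D_e^+`. It is computed along the
curve `|z_e^+| = s`, positively oriented, where `s` is the mid-point of `(|t_e| / ρ, ρ)`; all these
curves, for `s` in this interval, are in the class `γ_e`. -/
def period (ω : RegularDifferential N t) (e : E) : ℂ :=
  ∮ w in C(0, (‖t e‖ / ρ + ρ) / 2),
    ω.toFun (G.tgt e) ((N.coord (e, true)).symm w) * deriv (N.coord (e, true)).symm w

/-- `ω` belongs to the space `H^1_∞(Σ_t)`: the supremum of `|ω/dz|` over all the `Ω_{v,ε}`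
is finite. -/
def MemHInfty (ω : RegularDifferential N t) (ε : ℝ) : Prop :=
  ∃ M : ℝ, ∀ v, ∀ z ∈ N.Omega ε v ∩ N.sphereDomain t v, ‖ω.toFun v z‖ ≤ M

end RegularDifferential

end OpeningNodes

end

/-! On each sphere `ω/dz` is the sum of one principal part per end. At an end with parameter `t ≠ 0`
the principal part is the Cauchy integral of `ω` over the curve `|z_e| = 2|t|/ρ`; at a node it is
the simple pole. The difference between `ω/dz` and this sum extends to an entire function tending to
0 at infinity, so it vanishes (`eq_sum_principalPart`).

On that curve the gluing `u ↦ t/u` lands on the fixed circle of radius `ρ/2` at the opposite end.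
Comparing the kernel `1/(z - σ(u))` with `1/(z - p)`, whose integral gives the period, shows that a
principal part differs from its polar term by at most `4 c₂² |t| B / |z - p|²`, where `B` bounds
`|ω/dz|` on the opposite circle (`isPrincipalPart_curveCauchy`).

Let `A` be the supremum of `|ω/dz|` over all circles of radius `ρ/2`. Summing at most `2k` principal
parts gives `A ≤ const * ‖α‖ + (const * sup |t|) * A`, and for small `t` the last term is absorbed
(`circleSup_le_of_period_le`). This requires `A < ∞`, which follows from membership in the space of
bounded differentials and the maximum principle (`circleSup_le_of_memHInfty`).

In the annulus `|t|^{1/2} ≤ |z_e|` one has `|z - p|² ≥ c₁² |t|`, so the error of the principal part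
of that end is bounded by a multiple of `B`. The other principal parts at the vertex are evaluated
at a definite distance from their poles (`norm_sub_polarTerm_le`). -/

noncomputable section

namespace OpeningNodes

/-! ### Circle integrals and Cauchy's formula in an annulus -/

/-- The Cauchy integral of the differential `φ(u) du` along the curve `σ` restricted to the circle
`|u| = s`. -/
def curveCauchy (φ σ : ℂ → ℂ) (s : ℝ) (z : ℂ) : ℂ :=
  (2 * Real.pi * Complex.I)⁻¹ * ∮ u in C(0, s), φ u / (z - σ u)

/-- Differentiation under the integral sign: `z` lies at positive distance `r` from the compact
image curve, so the derivative of the kernel is dominated on the ball of radius `r / 2`. -/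
theorem curveCauchy_differentiableAt {φ σ : ℂ → ℂ} {s : ℝ} (hs : 0 ≤ s)
    (hφ : ContinuousOn φ (Metric.sphere 0 s)) (hσ : ContinuousOn σ (Metric.sphere 0 s)) {z : ℂ}
    (hz : z ∉ σ '' Metric.sphere 0 s) : DifferentiableAt ℂ (curveCauchy φ σ s) z := by
  have hK : IsCompact (σ '' Metric.sphere 0 s) := (isCompact_sphere 0 s).image_of_continuousOn hσ
  obtain ⟨r, hr, hball⟩ := Metric.isOpen_iff.1 hK.isClosed.isOpen_compl z hz
  have hdist : ∀ θ : ℝ, ∀ x ∈ Metric.ball z (r / 2), r / 2 ≤ ‖x - σ (circleMap 0 s θ)‖ := by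
    intro θ x hx
    by_contra! h
    rw [Metric.mem_ball, dist_comm] at hx
    rw [← dist_eq_norm] at h
    have hmem : σ (circleMap 0 s θ) ∈ Metric.ball z r := by
      rw [Metric.mem_ball, dist_comm]
      linarith [dist_triangle z x (σ (circleMap 0 s θ))]
    exact hball hmem (mem_image_of_mem _ (circleMap_mem_sphere 0 hs θ))
  have hne : ∀ θ : ℝ, ∀ x ∈ Metric.ball z (r / 2), x - σ (circleMap 0 s θ) ≠ 0 := by
    intro θ x hx h
    have := hdist θ x hx
    rw [h, norm_zero] at this
    linarith
  have hφc : Continuous fun θ : ℝ => φ (circleMap 0 s θ) :=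
    hφ.comp_continuous (continuous_circleMap 0 s) fun θ => circleMap_mem_sphere 0 hs θ
  have hσc : Continuous fun θ : ℝ => σ (circleMap 0 s θ) :=
    hσ.comp_continuous (continuous_circleMap 0 s) fun θ => circleMap_mem_sphere 0 hs θ
  have hdc : Continuous fun θ : ℝ => deriv (circleMap 0 s) θ := by
    simp only [deriv_circleMap]; fun_prop
  have hzb : z ∈ Metric.ball z (r / 2) := Metric.mem_ball_self (by positivity)
  have hF : ∀ x ∈ Metric.ball z (r / 2), Continuous fun θ : ℝ =>
      deriv (circleMap 0 s) θ • (φ (circleMap 0 s θ) / (x - σ (circleMap 0 s θ))) := fun x hx =>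
    hdc.smul (hφc.div (continuous_const.sub hσc) fun θ => hne θ x hx)
  have hF' : Continuous fun θ : ℝ =>
      deriv (circleMap 0 s) θ • (-φ (circleMap 0 s θ) / (z - σ (circleMap 0 s θ)) ^ 2) :=
    hdc.smul (hφc.neg.div ((continuous_const.sub hσc).pow 2) fun θ => pow_ne_zero 2 (hne θ z hzb))
  have key := intervalIntegral.hasDerivAt_integral_of_dominated_loc_of_deriv_le
    (μ := MeasureTheory.volume) (a := 0) (b := 2 * Real.pi)
    (F := fun x θ => deriv (circleMap 0 s) θ • (φ (circleMap 0 s θ) / (x - σ (circleMap 0 s θ))))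
    (F' := fun x θ => deriv (circleMap 0 s) θ •
      (-φ (circleMap 0 s θ) / (x - σ (circleMap 0 s θ)) ^ 2))
    (bound := fun θ => ‖deriv (circleMap 0 s) θ‖ * (‖φ (circleMap 0 s θ)‖ / (r / 2) ^ 2))
    (x₀ := z) (s := Metric.ball z (r / 2)) (Metric.ball_mem_nhds z (by positivity))
    (by
      filter_upwards [Metric.ball_mem_nhds z (show 0 < r / 2 by positivity)] with x hx
      exact (hF x hx).aestronglyMeasurable)
    ((hF z hzb).intervalIntegrable _ _) hF'.aestronglyMeasurable
    (by
      refine Eventually.of_forall fun θ _ x hx => ?_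
      rw [norm_smul, norm_div, norm_neg, norm_pow]
      have := hdist θ x hx
      gcongr)
    ((hdc.norm.mul (hφc.norm.div_const _)).intervalIntegrable _ _)
    (by
      refine Eventually.of_forall fun θ _ x hx => ?_
      have h1 : HasDerivAt (fun x => x - σ (circleMap 0 s θ)) 1 x :=
        (hasDerivAt_id x).sub_const _
      have h2 := (HasDerivAt.fun_div (hasDerivAt_const x (φ (circleMap 0 s θ))) h1
        (hne θ x hx)).const_mul (deriv (circleMap 0 s) θ)
      simpa using h2)
  exact (key.2.differentiableAt).const_mul _

/-- Change of variable `w = t / u` in a circle integral. -/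
theorem circleIntegral_inversion (Φ : ℂ → ℂ) {t : ℂ} (ht : t ≠ 0) {s : ℝ} (hs : 0 < s) :
    ∮ u in C(0, s), Φ (t / u) * (t / u ^ 2) = ∮ w in C(0, ‖t‖ / s), Φ w := by
  set Ψ : ℝ → ℂ := fun θ => deriv (circleMap 0 (‖t‖ / s)) θ • Φ (circleMap 0 (‖t‖ / s) θ)
    with hΨ
  have hs' : (s : ℂ) ≠ 0 := by exact_mod_cast hs.ne'
  have hper : Function.Periodic Ψ (2 * Real.pi) := by
    intro θ
    simp only [hΨ, deriv_circleMap, periodic_circleMap 0 (‖t‖ / s) θ]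
  -- The substitution acts on angles by `θ ↦ arg t - θ`. This reversal of orientation cancels the
  -- minus sign of `dw = -t / u² du`.
  have hmap : ∀ θ : ℝ, t / circleMap 0 s θ = circleMap 0 (‖t‖ / s) (t.arg - θ) := by
    intro θ
    have h : t = ‖t‖ * Complex.exp (t.arg * Complex.I) := (Complex.norm_mul_exp_arg_mul_I t).symm
    have he := Complex.exp_ne_zero (θ * Complex.I)
    simp only [circleMap, zero_add]
    rw [Complex.ofReal_sub, sub_mul, Complex.exp_sub]
    push_cast
    nth_rewrite 1 [h]
    field_simp
  have hint : ∀ θ : ℝ, deriv (circleMap 0 s) θ • (Φ (t / circleMap 0 s θ) *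
      (t / circleMap 0 s θ ^ 2)) = Ψ (t.arg - θ) := by
    intro θ
    have hc : circleMap 0 s θ ≠ 0 := circleMap_ne_center hs.ne'
    simp only [hΨ, deriv_circleMap, ← hmap, smul_eq_mul]
    field_simp
  calc ∮ u in C(0, s), Φ (t / u) * (t / u ^ 2)
      = ∫ θ in (0 : ℝ)..2 * Real.pi, Ψ (t.arg - θ) := by
        simp only [circleIntegral, hint]
    _ = ∫ θ in (t.arg - 2 * Real.pi)..(t.arg - 2 * Real.pi) + 2 * Real.pi, Ψ θ := by
        rw [intervalIntegral.integral_comp_sub_left]; simp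
    _ = ∫ θ in (0 : ℝ)..0 + 2 * Real.pi, Ψ θ := hper.intervalIntegral_add_eq _ _
    _ = ∮ w in C(0, ‖t‖ / s), Φ w := by simp [circleIntegral, hΨ]

theorem isOpen_annulus (r ρ : ℝ) : IsOpen {u : ℂ | r < ‖u‖ ∧ ‖u‖ < ρ} :=
  (isOpen_lt continuous_const continuous_norm).inter (isOpen_lt continuous_norm continuous_const)

theorem circleIntegral_eq_of_annulus {H : ℂ → ℂ} {r₀ ρ r R : ℝ}
    (hH : DifferentiableOn ℂ H {u | r₀ < ‖u‖ ∧ ‖u‖ < ρ}) (hr : 0 < r) (hr₀ : r₀ < r)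
    (hrR : r ≤ R) (hR : R < ρ) : ∮ u in C(0, R), H u = ∮ u in C(0, r), H u := by
  have hsub : ∀ u : ℂ, r ≤ ‖u‖ → ‖u‖ ≤ R → DifferentiableAt ℂ H u := fun u h1 h2 =>
    hH.differentiableAt ((isOpen_annulus r₀ ρ).mem_nhds ⟨hr₀.trans_le h1, h2.trans_lt hR⟩)
  refine Complex.circleIntegral_eq_of_differentiable_on_annulus_off_countable hr hrR
    countable_empty ?_ ?_
  · intro u hu
    simp only [Set.mem_sdiff, Metric.mem_closedBall, dist_zero_right, Metric.mem_ball, not_lt] at hu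
    exact (hsub u hu.2 hu.1).continuousAt.continuousWithinAt
  · intro u hu
    simp only [Set.mem_sdiff, Metric.mem_closedBall, dist_zero_right, Metric.mem_ball, not_le] at hu
    exact hsub u hu.1.2.le hu.1.1.le

/-- Cauchy's formula in an annulus. -/
theorem cauchy_annulus {H : ℂ → ℂ} {r₀ ρ r R : ℝ} {v : ℂ}
    (hH : DifferentiableOn ℂ H {u | r₀ < ‖u‖ ∧ ‖u‖ < ρ}) (hr : 0 < r) (hr₀ : r₀ < r)
    (hrv : r < ‖v‖) (hvR : ‖v‖ < R) (hR : R < ρ) :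
    (∮ u in C(0, R), H u / (u - v)) - ∮ u in C(0, r), H u / (u - v)
      = 2 * Real.pi * Complex.I * H v := by
  have hR0 : 0 < R := hr.trans (hrv.trans hvR)
  have hA : {u : ℂ | r₀ < ‖u‖ ∧ ‖u‖ < ρ} ∈ 𝓝 v :=
    (isOpen_annulus r₀ ρ).mem_nhds ⟨hr₀.trans hrv, hvR.trans hR⟩
  -- The difference quotient of `H` at `v` is holomorphic across `v`, so it has equal integrals over
  -- both circles; only `H v * ∮ (u - v)⁻¹` distinguishes them, being `2πi H v` outside and 0
  -- inside.
  have hd := (Complex.differentiableOn_dslope hA).2 hH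
  have heq := circleIntegral_eq_of_annulus hd hr hr₀ (hrv.trans hvR).le hR
  have hsplit : ∀ s, 0 < s → r₀ < s → s < ρ → s ≠ ‖v‖ →
      (∮ u in C(0, s), dslope H v u) =
        (∮ u in C(0, s), H u / (u - v)) - H v * ∮ u in C(0, s), (u - v)⁻¹ := by
    intro s hs h0s hsρ hsv
    have hne : ∀ u ∈ Metric.sphere (0 : ℂ) s, u - v ≠ 0 := by
      intro u hu h
      rw [sub_eq_zero] at h
      rw [h, mem_sphere_zero_iff_norm] at hu
      exact hsv hu.symm
    have hHc : ContinuousOn H (Metric.sphere 0 s) := hH.continuousOn.mono fun u hu => by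
      rw [mem_sphere_zero_iff_norm] at hu
      exact ⟨hu ▸ h0s, hu ▸ hsρ⟩
    have hi1 : CircleIntegrable (fun u => H u / (u - v)) 0 s :=
      (hHc.div (continuousOn_id.sub continuousOn_const) hne).circleIntegrable hs.le
    have hi2 : CircleIntegrable (fun u => H v * (u - v)⁻¹) 0 s :=
      (continuousOn_const.mul ((continuousOn_id.sub continuousOn_const).inv₀ hne)).circleIntegrable
        hs.le
    rw [← circleIntegral.integral_const_mul, ← circleIntegral.integral_sub hi1 hi2]
    refine circleIntegral.integral_congr hs.le fun u hu => ?_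
    have huv : u ≠ v := sub_ne_zero.1 (hne u hu)
    simp only [dslope_of_ne _ huv, slope_def_field]
    ring
  have hin : ∮ u in C(0, R), (u - v)⁻¹ = 2 * Real.pi * Complex.I :=
    circleIntegral.integral_sub_inv_of_mem_ball (by simpa using hvR)
  have hout : ∮ u in C(0, r), (u - v)⁻¹ = 0 := by
    refine Complex.circleIntegral_eq_zero_of_differentiable_on_off_countable hr.le
      countable_empty ?_ ?_
    · refine (continuousOn_id.sub continuousOn_const).inv₀ fun u hu h => ?_
      have h : u = v := sub_eq_zero.1 h
      rw [h, mem_closedBall_zero_iff] at hu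
      linarith
    · intro u hu
      refine DifferentiableAt.inv (by fun_prop) fun h => ?_
      rw [sub_eq_zero] at h
      rw [h, sdiff_empty, mem_ball_zero_iff] at hu
      linarith
  rw [hsplit R hR0 (by linarith) hR hvR.ne', hsplit r hr hr₀ (by linarith) hrv.ne, hin, hout] at heq
  linear_combination heq

/-! ### Holomorphic inverses and Laurent splitting in a conformal image -/

/-- The inverse of a holomorphic homeomorphism is holomorphic. -/
theorem differentiableOn_symm {φ : OpenPartialHomeomorph ℂ ℂ}
    (hφ : DifferentiableOn ℂ φ φ.source) : DifferentiableOn ℂ φ.symm φ.target := by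
  have hreg : ∀ u ∈ φ.target, deriv φ (φ.symm u) ≠ 0 → DifferentiableAt ℂ φ.symm u := by
    intro u hu hne
    exact (φ.hasDerivAt_symm hu hne (hφ.differentiableAt
      (φ.open_source.mem_nhds (φ.map_target hu))).hasDerivAt).differentiableAt
  intro u hu
  set z := φ.symm u with hz
  have hzs : z ∈ φ.source := φ.map_target hu
  have hcont : ContinuousAt φ.symm u := φ.symm.continuousAt hu
  have hderiv : AnalyticAt ℂ (deriv φ) z :=
    (hφ.analyticAt (φ.open_source.mem_nhds hzs)).deriv
  refine DifferentiableAt.differentiableWithinAt ?_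
  -- Either the derivative vanishes near `z`, and the map is locally constant, against injectivity;
  -- or its zero is at most isolated, and the continuous inverse has a removable singularity at `u`.
  rcases hderiv.eventually_eq_zero_or_eventually_ne_zero with h0 | h0
  · exfalso
    obtain ⟨r, hr, hb⟩ := Metric.eventually_nhds_iff_ball.1
      (h0.and (φ.open_source.mem_nhds hzs))
    have hconst : ∀ x ∈ Metric.ball z r, φ x = φ z := by
      intro x hx
      refine (Metric.isOpen_ball).is_const_of_deriv_eq_zero (convex_ball z r).isPreconnected
        (hφ.mono fun y hy => (hb y hy).2) (fun y hy => (hb y hy).1) hx (Metric.mem_ball_self hr)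
    have hx : z + (r / 2 : ℝ) ∈ Metric.ball z r := by
      simp [abs_of_pos hr]; linarith
    have := φ.injOn (hb _ hx).2 hzs (hconst _ hx)
    simp [hr.ne'] at this
  · refine (Complex.analyticAt_of_differentiable_on_punctured_nhds_of_continuousAt ?_
      hcont).differentiableAt
    have hp : Tendsto φ.symm (𝓝[≠] u) (𝓝[≠] z) := by
      refine tendsto_nhdsWithin_iff.2 ⟨hcont.tendsto.mono_left nhdsWithin_le_nhds, ?_⟩
      filter_upwards [mem_nhdsWithin_of_mem_nhds (φ.open_target.mem_nhds hu),
        self_mem_nhdsWithin] with w hw hwu h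
      exact hwu (φ.symm.injOn hw hu h)
    filter_upwards [mem_nhdsWithin_of_mem_nhds (φ.open_target.mem_nhds hu), hp.eventually h0]
      with w hw hne using hreg w hw hne

theorem deriv_mul_deriv_symm {φ : OpenPartialHomeomorph ℂ ℂ}
    (hφ : DifferentiableOn ℂ φ φ.source) {u : ℂ} (hu : u ∈ φ.target) :
    deriv φ (φ.symm u) * deriv φ.symm u = 1 := by
  have h1 := (hφ.differentiableAt (φ.open_source.mem_nhds (φ.map_target hu))).hasDerivAt
  have h2 := ((differentiableOn_symm hφ).differentiableAt (φ.open_target.mem_nhds hu)).hasDerivAt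
  have h3 := h1.comp u h2
  refine h3.unique ((hasDerivAt_id u).congr_of_eventuallyEq ?_)
  filter_upwards [φ.open_target.mem_nhds hu] with w hw using φ.right_inv hw

theorem dslope_ne_zero {σ : ℂ → ℂ} {S : Set ℂ} (hinj : InjOn σ S)
    (hσ' : ∀ u ∈ S, deriv σ u ≠ 0) {v : ℂ} (hv : v ∈ S) {u : ℂ} (hu : u ∈ S) :
    dslope σ v u ≠ 0 := by
  rcases eq_or_ne u v with rfl | h
  · simpa using hσ' u hu
  · rw [dslope_of_ne _ h, slope_def_field]
    exact div_ne_zero (sub_ne_zero.2 fun h' => h (hinj hu hv h')) (sub_ne_zero.2 h)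

/-- This quotient takes the value 1 at `u = v`, and dividing it by `u - v` gives `σ'(u) / (σ u - σ
v)`. It thus reduces Cauchy's formula along image curves to circles, with no winding numbers. -/
theorem differentiableOn_deriv_div_dslope {σ : ℂ → ℂ} {S : Set ℂ} (hS : IsOpen S)
    (hσ : DifferentiableOn ℂ σ S) (hinj : InjOn σ S) (hσ' : ∀ u ∈ S, deriv σ u ≠ 0) {v : ℂ}
    (hv : v ∈ S) : DifferentiableOn ℂ (fun u => deriv σ u / dslope σ v u) S :=
  (hσ.deriv hS).div ((Complex.differentiableOn_dslope (hS.mem_nhds hv)).2 hσ)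
    fun _ hu => dslope_ne_zero hinj hσ' hv hu

/-- Laurent splitting of a function in an annulus, in the image of the annulus by `σ`. -/
theorem laurent_splitting {σ F : ℂ → ℂ} {r₀ ρ r R : ℝ} {v : ℂ}
    (hσ : DifferentiableOn ℂ σ (Metric.ball 0 ρ)) (hinj : InjOn σ (Metric.ball 0 ρ))
    (hσ' : ∀ u ∈ Metric.ball 0 ρ, deriv σ u ≠ 0)
    (hF : DifferentiableOn ℂ F {u | r₀ < ‖u‖ ∧ ‖u‖ < ρ}) (hr : 0 < r) (hr₀ : r₀ < r)
    (hrv : r < ‖v‖) (hvR : ‖v‖ < R) (hR : R < ρ) :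
    F v = curveCauchy (fun u => F u * deriv σ u) σ r (σ v)
      - curveCauchy (fun u => F u * deriv σ u) σ R (σ v) := by
  have hv : v ∈ Metric.ball (0 : ℂ) ρ := by simpa using hvR.trans hR
  have hsub : {u : ℂ | r₀ < ‖u‖ ∧ ‖u‖ < ρ} ⊆ Metric.ball 0 ρ := fun u hu => by simpa using hu.2
  have hH := hF.mul
    ((differentiableOn_deriv_div_dslope Metric.isOpen_ball hσ hinj hσ' hv).mono hsub)
  have hc := cauchy_annulus hH hr hr₀ hrv hvR hR
  have hHv : (F * fun u => deriv σ u / dslope σ v u) v = F v := by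
    simp [div_self (hσ' v hv)]
  rw [hHv] at hc
  have hswap : ∀ s, 0 < s → s < ρ → s ≠ ‖v‖ →
      (∮ u in C(0, s), (F * fun u => deriv σ u / dslope σ v u) u / (u - v)) =
        - ∮ u in C(0, s), F u * deriv σ u / (σ v - σ u) := by
    intro s hs hsρ hsv
    rw [← neg_one_mul, ← circleIntegral.integral_const_mul]
    refine circleIntegral.integral_congr hs.le fun u hu => ?_
    rw [mem_sphere_zero_iff_norm] at hu
    have huv : u ≠ v := by rintro rfl; exact hsv hu.symm
    have hne : σ u - σ v ≠ 0 :=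
      sub_ne_zero.2 fun h => huv (hinj (by simpa [hu] using hsρ) hv h)
    have hne' : σ v - σ u ≠ 0 := by rw [← neg_sub]; exact neg_ne_zero.2 hne
    have huv' := sub_ne_zero.2 huv
    simp only [Pi.mul_apply, dslope_of_ne _ huv, slope_def_field]
    rw [← neg_sub (σ u) (σ v)]
    field_simp
  rw [hswap R (by linarith) hR hvR.ne', hswap r hr (by linarith) hrv.ne] at hc
  have hpi := Complex.two_pi_I_ne_zero
  simp only [curveCauchy]
  rw [← mul_sub, eq_inv_mul_iff_mul_eq₀ hpi]
  linear_combination -hc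

/-- Cauchy's formula at 0 for the holomorphic quotient `deriv σ u / dslope σ 0 u`. -/
theorem circleIntegral_deriv_div_sub {σ : ℂ → ℂ} {ρ s : ℝ}
    (hσ : DifferentiableOn ℂ σ (Metric.ball 0 ρ)) (hinj : InjOn σ (Metric.ball 0 ρ))
    (hσ' : ∀ u ∈ Metric.ball 0 ρ, deriv σ u ≠ 0) (hs : 0 < s) (hsρ : s < ρ) :
    ∮ u in C(0, s), deriv σ u / (σ u - σ 0) = 2 * Real.pi * Complex.I := by
  have h0 : (0 : ℂ) ∈ Metric.ball (0 : ℂ) ρ := by simpa using hs.trans hsρ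
  have hH := differentiableOn_deriv_div_dslope Metric.isOpen_ball hσ hinj hσ' h0
  have hsub : Metric.closedBall (0 : ℂ) s ⊆ Metric.ball 0 ρ := Metric.closedBall_subset_ball hsρ
  have := (hH.mono hsub).circleIntegral_sub_inv_smul (w := 0) (by simpa using hs)
  simp only [dslope_same, div_self (hσ' 0 h0), smul_eq_mul, mul_one] at this
  rw [← this]
  refine circleIntegral.integral_congr hs.le fun u hu => ?_
  rw [mem_sphere_zero_iff_norm] at hu
  have hu0 : u ≠ 0 := by rintro rfl; simp at hu; exact hs.ne hu
  have hne : σ u - σ 0 ≠ 0 :=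
    sub_ne_zero.2 fun h => hu0 (hinj (by simpa [hu] using hsρ) h0 h)
  simp only [dslope_of_ne _ hu0, slope_def_field, sub_zero]
  field_simp

/-! ### Ends of edges and geometry of the coordinate disks -/

variable {V E : Type*}

/-- The other end of the same edge. -/
def EdgeEnd.flip (h : EdgeEnd E) : EdgeEnd E := (h.1, !h.2)

theorem EdgeEnd.flip_flip (h : EdgeEnd E) : EdgeEnd.flip (EdgeEnd.flip h) = h := by
  simp [EdgeEnd.flip]

/-- The degree counts edges; the factor 2 is there because a loop has both ends at `v`. -/
theorem OrientedMultigraph.DegreeLE.exists_finset {G : OrientedMultigraph V E} {k : ℕ}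
    (hG : G.DegreeLE k) (v : V) :
    ∃ S : Finset (EdgeEnd E), (∀ h, h ∈ S ↔ G.vertexOf h = v) ∧ S.card ≤ 2 * k := by
  have hfin : (G.edgesAt v).Finite := Set.finite_of_encard_le_coe (hG v)
  have hcard : hfin.toFinset.card ≤ k := by
    have := hG v
    rw [hfin.encard_eq_coe_toFinset_card] at this
    exact_mod_cast this
  classical
  refine ⟨(hfin.toFinset ×ˢ Finset.univ).filter fun h => G.vertexOf h = v, fun h => ?_, ?_⟩
  · rw [Finset.mem_filter, Finset.mem_product, Set.Finite.mem_toFinset]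
    refine ⟨fun H => H.2, fun H => ⟨⟨?_, Finset.mem_univ _⟩, H⟩⟩
    rw [OrientedMultigraph.vertexOf] at H
    split_ifs at H
    exacts [Or.inr H, Or.inl H]
  · refine (Finset.card_filter_le _ _).trans ?_
    rw [Finset.card_product]
    simp only [Finset.card_univ, Fintype.card_bool]
    omega

namespace AdmissibleCoordinates

variable {G : OrientedMultigraph V E} {ρ c₁ c₂ : ℝ} (N : AdmissibleCoordinates G ρ c₁ c₂)

/-- The parametrization of the disk of an end by the ball of radius `ρ`. -/
def param (h : EdgeEnd E) : ℂ → ℂ := (N.coord h).symm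

variable {N}

theorem mem_target {h : EdgeEnd E} {u : ℂ} (hu : ‖u‖ < ρ) : u ∈ (N.coord h).target := by
  rw [N.target_eq]; simpa using hu

theorem param_mem_disk {h : EdgeEnd E} {u : ℂ} (hu : ‖u‖ < ρ) : N.param h u ∈ N.disk h :=
  (N.coord h).map_target (mem_target hu)

theorem coord_param {h : EdgeEnd E} {u : ℂ} (hu : ‖u‖ < ρ) : N.coord h (N.param h u) = u :=
  (N.coord h).right_inv (mem_target hu)

theorem param_coord {h : EdgeEnd E} {z : ℂ} (hz : z ∈ N.disk h) :
    N.param h (N.coord h z) = z := (N.coord h).left_inv hz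

theorem norm_coord_lt {h : EdgeEnd E} {z : ℂ} (hz : z ∈ N.disk h) : ‖N.coord h z‖ < ρ := by
  have := (N.coord h).map_source hz
  rw [N.target_eq] at this
  simpa using this

theorem param_zero (h : EdgeEnd E) : N.param h 0 = N.p h := by
  rw [← N.coord_p h]; exact param_coord (N.p_mem h)

theorem differentiableOn_param (h : EdgeEnd E) :
    DifferentiableOn ℂ (N.param h) (Metric.ball 0 ρ) := by
  rw [← N.target_eq h]; exact differentiableOn_symm (N.holo h)

theorem injOn_param (h : EdgeEnd E) : InjOn (N.param h) (Metric.ball 0 ρ) := by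
  rw [← N.target_eq h]; exact (N.coord h).symm.injOn

theorem deriv_param_ne_zero (h : EdgeEnd E) {u : ℂ} (hu : u ∈ Metric.ball (0 : ℂ) ρ) :
    deriv (N.param h) u ≠ 0 := by
  rw [← N.target_eq h] at hu
  exact right_ne_zero_of_mul_eq_one (deriv_mul_deriv_symm (N.holo h) hu)

theorem norm_param_sub_le {h : EdgeEnd E} {u : ℂ} (hu : ‖u‖ < ρ) :
    ‖N.param h u - N.p h‖ ≤ c₂ * ‖u‖ := by
  simpa [coord_param hu] using N.upper h _ (param_mem_disk hu)

theorem isOpen_disk (h : EdgeEnd E) : IsOpen (N.disk h) := (N.coord h).open_source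

theorem isCompact_param_image {h : EdgeEnd E} {r : ℝ} (hr : r < ρ) :
    IsCompact (N.param h '' Metric.closedBall 0 r) :=
  (isCompact_closedBall 0 r).image_of_continuousOn
    ((differentiableOn_param h).continuousOn.mono (Metric.closedBall_subset_ball hr))

theorem mem_param_image {h : EdgeEnd E} {r : ℝ} (hr : r < ρ) {z : ℂ} :
    z ∈ N.param h '' Metric.closedBall 0 r ↔ z ∈ N.disk h ∧ ‖N.coord h z‖ ≤ r := by
  constructor
  · rintro ⟨u, hu, rfl⟩
    rw [mem_closedBall_zero_iff] at hu
    exact ⟨param_mem_disk (hu.trans_lt hr), by rwa [coord_param (hu.trans_lt hr)]⟩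
  · rintro ⟨hz, hu⟩
    exact ⟨_, by simpa using hu, param_coord hz⟩

theorem isClosed_coord_le (h : EdgeEnd E) {r : ℝ} (hr : r < ρ) :
    IsClosed {z | z ∈ N.disk h ∧ ‖N.coord h z‖ ≤ r} := by
  convert (isCompact_param_image (N := N) (h := h) hr).isClosed using 1
  ext z; exact (mem_param_image hr).symm

theorem isOpen_coord_lt (h : EdgeEnd E) (r : ℝ) :
    IsOpen {z | z ∈ N.disk h ∧ ‖N.coord h z‖ < r} := by
  convert (N.coord h).isOpen_inter_preimage (Metric.isOpen_ball (x := (0 : ℂ)) (ε := r)) using 1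
  ext z
  simp [disk]

/-- The disk of an end contains a round disk of controlled radius. -/
theorem mem_disk_of_norm_sub_lt (hc₁ : 0 < c₁) {h : EdgeEnd E} {z : ℂ}
    (hz : ‖z - N.p h‖ < c₁ * ρ) : z ∈ N.disk h := by
  have hsub : Metric.ball (N.p h) (c₁ * ρ) ⊆ N.disk h := by
    have hcr : 0 < c₁ * ρ := (norm_nonneg _).trans_lt hz
    -- The round ball is connected and meets the disk, so it suffices that a limit point of the disk
    -- inside the ball is in the disk. Near such a point the coordinate is at most `m / c₁ < ρ`, a
    -- condition that defines a closed set.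
    refine (convex_ball _ _).isPreconnected.subset_of_closure_inter_subset (isOpen_disk h)
      ⟨N.p h, Metric.mem_ball_self hcr, N.p_mem h⟩ ?_
    rintro x ⟨hx, hxb⟩
    rw [mem_ball_iff_norm] at hxb
    obtain ⟨m, hm1, hm2⟩ := exists_between hxb
    have hmρ : m / c₁ < ρ := (div_lt_iff₀' hc₁).2 hm2
    have hcl := (isClosed_coord_le (N := N) h hmρ).closure_eq
    have : x ∈ closure {z | z ∈ N.disk h ∧ ‖N.coord h z‖ ≤ m / c₁} := by
      have hx' : x ∈ closure (Metric.ball (N.p h) m ∩ N.disk h) :=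
        Metric.isOpen_ball.inter_closure ⟨mem_ball_iff_norm.2 hm1, hx⟩
      refine closure_mono ?_ hx'
      rintro y ⟨hy, hyd⟩
      rw [mem_ball_iff_norm] at hy
      refine ⟨hyd, (le_div_iff₀' hc₁).2 ((N.lower h y hyd).trans hy.le)⟩
    rw [hcl] at this
    exact this.1
  exact hsub (mem_ball_iff_norm.2 hz)

/-- Inside the disk this is the lower admissibility bound; a point outside the disk is also outside
the round ball of radius `c₁ * ρ`. -/
theorem norm_sub_ge_of_forall_coord_ge (hc₁ : 0 < c₁) {h : EdgeEnd E} {r : ℝ} (hr : r ≤ ρ) {z : ℂ}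
    (hz : z ∈ N.disk h → r ≤ ‖N.coord h z‖) : c₁ * r ≤ ‖z - N.p h‖ := by
  by_contra! hlt
  have hd : z ∈ N.disk h := mem_disk_of_norm_sub_lt hc₁ (hlt.trans_le (by gcongr))
  exact absurd ((mul_le_mul_of_nonneg_left (hz hd) hc₁.le).trans (N.lower h z hd)) hlt.not_ge

/-- Cauchy's estimate on circles of radius `r < ρ / 2` about `u`, which stay in the ball where
`|param - p| ≤ c₂ ρ`; then `r → ρ / 2`. -/
theorem norm_deriv_param_le (hρ : 0 < ρ) (hc₂ : 0 < c₂) {h : EdgeEnd E} {u : ℂ}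
    (hu : ‖u‖ = ρ / 2) : ‖deriv (N.param h) u‖ ≤ 2 * c₂ := by
  have key : ∀ r ∈ Ioo 0 (ρ / 2), ‖deriv (N.param h) u‖ ≤ c₂ * ρ / r := by
    intro r hr
    have hsub : Metric.closedBall u r ⊆ Metric.ball 0 ρ := by
      intro w hw
      rw [mem_closedBall_iff_norm] at hw
      rw [mem_ball_zero_iff]
      linarith [norm_le_norm_add_norm_sub u w, hr.2, norm_sub_rev u w]
    have hd : DiffContOnCl ℂ (fun w => N.param h w - N.p h) (Metric.ball u r) := by
      refine DifferentiableOn.diffContOnCl ?_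
      rw [closure_ball _ hr.1.ne']
      exact ((differentiableOn_param h).mono hsub).sub_const _
    have := Complex.norm_deriv_le_of_forall_mem_sphere_norm_le (C := c₂ * ρ) hr.1 hd ?_
    · simpa using this
    · intro w hw
      have hw' : ‖w‖ < ρ := by simpa using hsub (Metric.sphere_subset_closedBall hw)
      exact (norm_param_sub_le hw').trans (by gcongr)
  have hlim : Tendsto (fun r : ℝ => c₂ * ρ / r) (𝓝[<] (ρ / 2)) (𝓝 (c₂ * ρ / (ρ / 2))) :=
    (tendsto_const_nhds.div tendsto_id (by positivity)).mono_left nhdsWithin_le_nhds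
  have hle := ge_of_tendsto hlim (by
    filter_upwards [Ioo_mem_nhdsLT (show (0 : ℝ) < ρ / 2 by positivity)] with r hr using key r hr)
  calc _ ≤ _ := hle
    _ = 2 * c₂ := by field_simp

theorem notMem_disk_of_mem_closure {h h' : EdgeEnd E} (hne : h ≠ h')
    (hv : G.vertexOf h = G.vertexOf h') {z : ℂ} (hz : z ∈ closure (N.disk h)) :
    z ∉ N.disk h' := fun hz' =>
  ((N.disjoint h h' hne hv).closure_left (isOpen_disk h')).notMem_of_mem_left hz hz'

theorem mem_sphereDomain_of_mem_closure {t : E → ℂ} {h : EdgeEnd E} {z : ℂ}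
    (hz : z ∈ closure (N.disk h)) (hzt : z ∈ N.disk h → ‖t h.1‖ / ρ < ‖N.coord h z‖) :
    z ∈ N.sphereDomain t (G.vertexOf h) := by
  intro h' hv hr
  rcases eq_or_ne h h' with rfl | hne
  · exact absurd hr.2 (hzt hr.1).not_ge
  · exact notMem_disk_of_mem_closure hne hv.symm hz hr.1

theorem param_mem_sphereDomain {t : E → ℂ} {h : EdgeEnd E} {u : ℂ} (hu : ‖u‖ < ρ)
    (hut : ‖t h.1‖ / ρ < ‖u‖) : N.param h u ∈ N.sphereDomain t (G.vertexOf h) :=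
  mem_sphereDomain_of_mem_closure (subset_closure (param_mem_disk hu)) fun _ => by
    rwa [coord_param hu]

end AdmissibleCoordinates

/-! ### Local expressions of the differential and its periods -/

namespace RegularDifferential

open AdmissibleCoordinates

variable {G : OrientedMultigraph V E} {ρ c₁ c₂ : ℝ}
  {N : AdmissibleCoordinates G ρ c₁ c₂} {t : E → ℂ}

/-- The differential `ω` near an end, as a function on the sphere of that end. -/
def atEnd (ω : RegularDifferential N t) (h : EdgeEnd E) : ℂ → ℂ := ω.toFun (G.vertexOf h)

/-- The coefficient of `ω` in the local coordinate of an end. -/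
def localCoeff (ω : RegularDifferential N t) (h : EdgeEnd E) (u : ℂ) : ℂ :=
  ω.atEnd h (N.param h u) * deriv (N.param h) u

/-- The period along the boundary of the disk of an end, oriented as the boundary of the disk. -/
def endPeriod (ω : RegularDifferential N t) (h : EdgeEnd E) : ℂ :=
  if h.2 = true then ω.period h.1 else -ω.period h.1

variable (ω : RegularDifferential N t)

theorem localCoeff_true_eq {e : E} (hρ : 0 < ρ) (hte : t e ≠ 0) {u : ℂ} (hu : ‖u‖ < ρ)
    (hut : ‖t e‖ / ρ < ‖u‖) :
    ω.localCoeff (e, false) u = ω.localCoeff (e, true) (t e / u) * (-t e / u ^ 2) := by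
  have hu0 : u ≠ 0 := by
    rintro rfl
    rw [norm_zero] at hut
    exact hut.not_ge (by positivity)
  have hz := param_mem_disk (N := N) (h := (e, false)) hu
  have hneck := ω.neck e hte _ hz (by rwa [coord_param hu])
  have htu : ‖t e / u‖ < ρ := by
    rw [norm_div, div_lt_iff₀ (norm_pos_iff.2 hu0)]
    rwa [div_lt_iff₀' hρ] at hut
  have hc : HasDerivAt (N.coord (e, false)) (deriv (N.coord (e, false)) (N.param (e, false) u))
      (N.param (e, false) u) :=
    ((N.holo _).differentiableAt ((isOpen_disk _).mem_nhds hz)).hasDerivAt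
  have hinv : HasDerivAt (fun z => t e / N.coord (e, false) z)
      (-(t e * deriv (N.coord (e, false)) (N.param (e, false) u)) / u ^ 2)
      (N.param (e, false) u) := by
    have := HasDerivAt.fun_div (hasDerivAt_const (N.param (e, false) u) (t e)) hc
      (by rwa [coord_param hu])
    simpa [coord_param hu] using this
  have hs : HasDerivAt (N.param (e, true)) (deriv (N.param (e, true)) (t e / u))
      (t e / N.coord (e, false) (N.param (e, false) u)) := by
    rw [coord_param hu]
    exact ((differentiableOn_param _).differentiableAt
      (Metric.isOpen_ball.mem_nhds (by simpa using htu))).hasDerivAt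
  have hg : deriv (N.gluing t e) (N.param (e, false) u) = deriv (N.param (e, true)) (t e / u) *
      (-(t e * deriv (N.coord (e, false)) (N.param (e, false) u)) / u ^ 2) :=
    (HasDerivAt.comp (N.param (e, false) u) hs hinv).deriv
  have hone : deriv (N.coord (e, false)) (N.param (e, false) u) *
      deriv (N.param (e, false)) u = 1 :=
    deriv_mul_deriv_symm (N.holo _) (mem_target hu)
  have hgl : N.gluing t e (N.param (e, false) u) = N.param (e, true) (t e / u) := by
    simp only [gluing, coord_param hu]; rfl
  have h1 : ω.atEnd (e, false) (N.param (e, false) u) =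
      ω.atEnd (e, true) (N.param (e, true) (t e / u)) * deriv (N.gluing t e) (N.param (e, false) u)
      := by rw [← hgl]; exact hneck
  simp only [localCoeff, h1, hg]
  linear_combination (ω.atEnd (e, true) (N.param (e, true) (t e / u)) *
    deriv (N.param (e, true)) (t e / u) * (-t e / u ^ 2)) * hone

/-- The two local expressions of `ω` in a neck are related by the gluing map. -/
theorem localCoeff_flip_eq {h : EdgeEnd E} (hρ : 0 < ρ) (hte : t h.1 ≠ 0) {u : ℂ} (hu : ‖u‖ < ρ)
    (hut : ‖t h.1‖ / ρ < ‖u‖) :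
    ω.localCoeff h u = ω.localCoeff h.flip (t h.1 / u) * (-t h.1 / u ^ 2) := by
  obtain ⟨e, _ | _⟩ := h
  · exact ω.localCoeff_true_eq hρ hte hu hut
  · simp only at hte hut
    have hu0 : u ≠ 0 := by
      rintro rfl
      rw [norm_zero] at hut
      exact hut.not_ge (by positivity)
    have hup := norm_pos_iff.2 hu0
    have htu : ‖t e / u‖ < ρ := by
      rw [norm_div, div_lt_iff₀ hup]
      rwa [div_lt_iff₀' hρ] at hut
    have htu' : ‖t e‖ / ρ < ‖t e / u‖ := by
      rw [norm_div]
      exact div_lt_div_of_pos_left (norm_pos_iff.2 hte) hup hu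
    have := ω.localCoeff_true_eq hρ hte htu htu'
    simp only [EdgeEnd.flip, Bool.not_true]
    rw [this, div_div_cancel₀ hte]
    field_simp

theorem differentiableOn_atEnd_param (h : EdgeEnd E) :
    DifferentiableOn ℂ (fun u => ω.atEnd h (N.param h u)) {u | ‖t h.1‖ / ρ < ‖u‖ ∧ ‖u‖ < ρ} :=
  (ω.holo (G.vertexOf h)).comp
    ((differentiableOn_param h).mono fun u hu => by simpa using hu.2)
    fun _ hu => param_mem_sphereDomain hu.2 hu.1

theorem differentiableOn_localCoeff (h : EdgeEnd E) :
    DifferentiableOn ℂ (ω.localCoeff h) {u | ‖t h.1‖ / ρ < ‖u‖ ∧ ‖u‖ < ρ} :=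
  (ω.differentiableOn_atEnd_param h).mul
    (((differentiableOn_param h).deriv Metric.isOpen_ball).mono fun u hu => by simpa using hu.2)

theorem circleIntegral_localCoeff_true (hρ : 0 < ρ)
    (ht : ∀ e, ‖t e‖ < ρ ^ 2) (e : E) {s : ℝ} (hs : ‖t e‖ / ρ < s) (hsρ : s < ρ) :
    ∮ u in C(0, s), ω.localCoeff (e, true) u = ω.period e := by
  have hd := ω.differentiableOn_localCoeff (e, true)
  have h0 : 0 ≤ ‖t e‖ / ρ := by positivity
  have hm : ‖t e‖ / ρ < ρ := (div_lt_iff₀ hρ).2 (by simpa [sq] using ht e)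
  change _ = ∮ u in C(0, (‖t e‖ / ρ + ρ) / 2), ω.localCoeff (e, true) u
  rcases le_total s ((‖t e‖ / ρ + ρ) / 2) with hle | hle
  · exact (circleIntegral_eq_of_annulus hd (h0.trans_lt hs) hs hle (by linarith)).symm
  · exact circleIntegral_eq_of_annulus hd (by linarith) (by linarith) hle hsρ

/-- At a starting end, the gluing carries the circle of radius `s` to the circle of radius `|t| / s`
at the other end with reversed orientation, hence the sign in `endPeriod`. -/
theorem circleIntegral_localCoeff (hρ : 0 < ρ)
    (ht : ∀ e, ‖t e‖ < ρ ^ 2) {h : EdgeEnd E} (hte : t h.1 ≠ 0) {s : ℝ} (hs : ‖t h.1‖ / ρ < s)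
    (hsρ : s < ρ) : ∮ u in C(0, s), ω.localCoeff h u = ω.endPeriod h := by
  obtain ⟨e, _ | _⟩ := h
  · simp only at hte hs
    have hs0 : 0 < s := lt_of_le_of_lt (by positivity) hs
    have h1 : ∮ u in C(0, s), ω.localCoeff (e, false) u =
        ∮ u in C(0, s), -1 * (ω.localCoeff (e, true) (t e / u) * (t e / u ^ 2)) := by
      refine circleIntegral.integral_congr hs0.le fun u hu => ?_
      rw [mem_sphere_zero_iff_norm] at hu
      rw [ω.localCoeff_true_eq hρ hte (by rwa [hu]) (by rwa [hu])]
      ring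
    rw [h1, circleIntegral.integral_const_mul, circleIntegral_inversion _ hte hs0,
      ω.circleIntegral_localCoeff_true hρ ht e]
    · simp [endPeriod]
    · exact div_lt_div_of_pos_left (norm_pos_iff.2 hte) hs0 hsρ
    · rw [div_lt_iff₀ hs0]
      rwa [div_lt_iff₀' hρ] at hs
  · simpa [endPeriod] using ω.circleIntegral_localCoeff_true hρ ht e hs hsρ

end RegularDifferential

/-! ### Principal parts at the ends -/

namespace AdmissibleCoordinates

variable {G : OrientedMultigraph V E} {ρ c₁ c₂ : ℝ}

/-- The disk `|z_e^±| ≤ 2 |t_e| / ρ`. -/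
def core (N : AdmissibleCoordinates G ρ c₁ c₂) (t : E → ℂ) (h : EdgeEnd E) : Set ℂ :=
  {z | z ∈ N.disk h ∧ ‖N.coord h z‖ ≤ 2 * ‖t h.1‖ / ρ}

variable {N : AdmissibleCoordinates G ρ c₁ c₂} {t : E → ℂ} {h : EdgeEnd E}

theorem two_mul_norm_div_lt (hρ : 0 < ρ) (ht : ‖t h.1‖ < ρ ^ 2 / 2) : 2 * ‖t h.1‖ / ρ < ρ := by
  rw [div_lt_iff₀ hρ]; nlinarith

theorem isClosed_core (hρ : 0 < ρ) (ht : ‖t h.1‖ < ρ ^ 2 / 2) : IsClosed (N.core t h) :=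
  isClosed_coord_le h (two_mul_norm_div_lt hρ ht)

theorem removed_subset_core (hρ : 0 < ρ) : N.removed t h ⊆ N.core t h := fun z hz =>
  ⟨hz.1, hz.2.trans (by gcongr; linarith [norm_nonneg (t h.1)])⟩

end AdmissibleCoordinates

namespace RegularDifferential

open AdmissibleCoordinates

variable {G : OrientedMultigraph V E} {ρ c₁ c₂ : ℝ}
  {N : AdmissibleCoordinates G ρ c₁ c₂} {t : E → ℂ}

variable (ω : RegularDifferential N t)

/-- The polar term `α_e^± / (2πi (z - p_e^±))` at an end. -/
def polarTerm (h : EdgeEnd E) (z : ℂ) : ℂ :=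
  ω.endPeriod h / (2 * Real.pi * Complex.I * (z - N.p h))

theorem circleIntegral_localCoeff_of_simplePole {h : EdgeEnd E} (ht : t h.1 = 0) {a : ℂ}
    (ha : SimplePoleWithResidue (ω.atEnd h) (N.p h) a) {s : ℝ} (hs : 0 < s) (hsρ : s < ρ) :
    ∮ u in C(0, s), ω.localCoeff h u = 2 * Real.pi * Complex.I * a := by
  obtain ⟨g, hg, hfg⟩ := ha
  set σ := N.param h with hσ
  have hσd : DifferentiableOn ℂ σ (Metric.ball 0 ρ) := differentiableOn_param h
  have hball : ∀ u : ℂ, ‖u‖ < ρ → Metric.ball (0 : ℂ) ρ ∈ 𝓝 u := fun u hu =>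
    Metric.isOpen_ball.mem_nhds (by simpa using hu)
  have hσ0 : σ 0 = N.p h := param_zero h
  have hρ : 0 < ρ := hs.trans hsρ
  have h00 : ‖(0 : ℂ)‖ < ρ := by simpa using hρ
  have hne : ∀ u : ℂ, ‖u‖ < ρ → u ≠ 0 → σ u - N.p h ≠ 0 := by
    intro u hu hu0 h'
    rw [← hσ0, sub_eq_zero] at h'
    exact hu0 (injOn_param h (by simpa using hu) (by simpa using hρ) h')
  have hfd : ∀ u : ℂ, ‖u‖ < ρ → u ≠ 0 → DifferentiableAt ℂ (fun u => ω.atEnd h (σ u)) u := by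
    intro u hu hu0
    refine (ω.differentiableOn_atEnd_param h).differentiableAt
      ((isOpen_annulus _ _).mem_nhds ⟨?_, hu⟩)
    simpa [ht] using hu0
  -- The pole removed: the value at 0 makes `k` continuous there. Cauchy's theorem tolerates this
  -- one point where differentiability is not checked.
  set k : ℂ → ℂ := fun u => if u = 0 then g (N.p h) else ω.atEnd h (σ u) - a / (σ u - N.p h)
    with hk
  have hkd : ∀ u : ℂ, ‖u‖ < ρ → u ≠ 0 → DifferentiableAt ℂ k u := by
    intro u hu hu0
    have h1 : DifferentiableAt ℂ (fun u => ω.atEnd h (σ u) - a / (σ u - N.p h)) u :=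
      (hfd u hu hu0).sub ((differentiableAt_const _).div
        ((hσd.differentiableAt (hball u hu)).sub_const _) (hne u hu hu0))
    refine h1.congr_of_eventuallyEq ?_
    filter_upwards [isOpen_ne.mem_nhds hu0] with w hw
    simp only [hk, if_neg hw]
  have hkc : ContinuousAt k 0 := by
    have hg' : ContinuousAt (fun u => g (σ u)) 0 := by
      refine ContinuousAt.comp ?_ (hσd.differentiableAt (hball 0 h00)).continuousAt
      rw [hσ0]; exact hg.continuousAt
    refine hg'.congr ?_
    have hpun : ∀ᶠ u in 𝓝[≠] (0 : ℂ), k u = g (σ u) := by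
      have hp : Tendsto σ (𝓝[≠] 0) (𝓝[≠] (N.p h)) := by
        refine tendsto_nhdsWithin_iff.2 ⟨?_, ?_⟩
        · rw [← hσ0]
          exact (hσd.differentiableAt (hball 0 h00)).continuousAt.tendsto.mono_left
            nhdsWithin_le_nhds
        · filter_upwards [mem_nhdsWithin_of_mem_nhds (hball 0 h00), self_mem_nhdsWithin]
            with u hu hu0
          exact sub_ne_zero.1 (hne u (by simpa using hu) hu0)
      filter_upwards [hp.eventually hfg, self_mem_nhdsWithin] with u hu hu0
      simp only [hk, if_neg (show u ≠ 0 from hu0), hu]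
      ring
    have := eventually_nhdsWithin_iff.1 hpun
    filter_upwards [this] with u hu
    rcases eq_or_ne u 0 with rfl | hu0
    · simp only [hk, if_true, hσ0]
    · exact (hu hu0).symm
  have hzero : ∮ u in C(0, s), k u * deriv σ u = 0 := by
    refine Complex.circleIntegral_eq_zero_of_differentiable_on_off_countable hs.le
      (countable_singleton 0) ?_ ?_
    · intro u hu
      have hu' : ‖u‖ < ρ := (mem_closedBall_zero_iff.1 hu).trans_lt hsρ
      have hkcu : ContinuousAt k u := by
        rcases eq_or_ne u 0 with rfl | hu0
        · exact hkc
        · exact (hkd u hu' hu0).continuousAt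
      exact (hkcu.mul ((hσd.deriv Metric.isOpen_ball).differentiableAt
        (hball u hu')).continuousAt).continuousWithinAt
    · intro u hu
      have hu' : ‖u‖ < ρ := (mem_ball_zero_iff.1 hu.1).trans hsρ
      exact (hkd u hu' hu.2).mul
        ((hσd.deriv Metric.isOpen_ball).differentiableAt (hball u hu'))
  have hsph : ∀ u ∈ Metric.sphere (0 : ℂ) s, ‖u‖ < ρ ∧ u ≠ 0 := by
    intro u hu
    rw [mem_sphere_zero_iff_norm] at hu
    refine ⟨hu ▸ hsρ, ?_⟩
    rintro rfl
    rw [norm_zero] at hu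
    exact hs.ne hu
  have hi1 : CircleIntegrable (fun u => k u * deriv σ u) 0 s := by
    refine ContinuousOn.circleIntegrable hs.le fun u hu => ?_
    have := hsph u hu
    exact ((hkd u this.1 this.2).continuousAt.mul ((hσd.deriv Metric.isOpen_ball).differentiableAt
      (hball u this.1)).continuousAt).continuousWithinAt
  have hi2 : CircleIntegrable (fun u => a * (deriv σ u / (σ u - σ 0))) 0 s := by
    refine ContinuousOn.circleIntegrable hs.le fun u hu => ?_
    have := hsph u hu
    refine (continuousAt_const.mul (((hσd.deriv Metric.isOpen_ball).differentiableAt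
      (hball u this.1)).continuousAt.div
      ((hσd.differentiableAt (hball u this.1)).sub_const _).continuousAt ?_)).continuousWithinAt
    rw [hσ0]; exact hne u this.1 this.2
  calc ∮ u in C(0, s), ω.localCoeff h u
      = ∮ u in C(0, s), (k u * deriv σ u + a * (deriv σ u / (σ u - σ 0))) := by
        refine circleIntegral.integral_congr hs.le fun u hu => ?_
        have := hsph u hu
        simp only [localCoeff, hk, if_neg this.2, hσ0]
        ring
    _ = (∮ u in C(0, s), k u * deriv σ u) + ∮ u in C(0, s), a * (deriv σ u / (σ u - σ 0)) :=
        circleIntegral.integral_add hi1 hi2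
    _ = 2 * Real.pi * Complex.I * a := by
        rw [hzero, circleIntegral.integral_const_mul,
          circleIntegral_deriv_div_sub hσd (injOn_param h) (fun u hu => deriv_param_ne_zero h hu)
            hs hsρ]
        ring

/-- At a node, the residue is given by the period. -/
theorem simplePole_of_node (hρ : 0 < ρ) {h : EdgeEnd E} (ht : t h.1 = 0) :
    SimplePoleWithResidue (ω.atEnd h) (N.p h) (ω.endPeriod h / (2 * Real.pi * Complex.I)) := by
  obtain ⟨e, b⟩ := h
  obtain ⟨a, h1, h2⟩ := ω.node e ht
  have hper : ω.period e = 2 * Real.pi * Complex.I * a := by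
    have hpos : 0 < ρ / 2 := by positivity
    rw [← ω.circleIntegral_localCoeff_of_simplePole (h := (e, true)) ht h1 hpos (by linarith)]
    have hte : ‖t e‖ = 0 := by simpa using ht
    change ∮ u in C(0, (‖t e‖ / ρ + ρ) / 2), ω.localCoeff (e, true) u = _
    rw [hte, zero_div, zero_add]
  have hpi := Complex.two_pi_I_ne_zero
  cases b
  · have : ω.endPeriod (e, false) / (2 * Real.pi * Complex.I) = -a := by
      rw [div_eq_iff hpi]; simp [endPeriod, hper]; ring
    rw [this]; exact h2
  · have : ω.endPeriod (e, true) / (2 * Real.pi * Complex.I) = a := by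
      rw [div_eq_iff hpi]; simp [endPeriod, hper]; ring
    rw [this]; exact h1

/-- `P` is the principal part of `ω` at an end: it is holomorphic outside of the core and removes
the singularity of `ω` in the core. Outside of the core it is close to the polar term, the
difference being controlled by the values of `ω` on a fixed circle at the opposite end. -/
structure IsPrincipalPart (h : EdgeEnd E) (P : ℂ → ℂ) : Prop where
  diff : DifferentiableOn ℂ P (N.core t h)ᶜ
  ext : ∃ (D : Set ℂ) (q : ℂ → ℂ), IsOpen D ∧ N.core t h ⊆ D ∧ D ⊆ N.disk h ∧
    DifferentiableOn ℂ q D ∧ ∀ z ∈ D \ N.core t h, ω.atEnd h z = P z + q z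
  bound : ∀ B, (∀ u : ℂ, ‖u‖ = ρ / 2 → ‖ω.atEnd h.flip (N.param h.flip u)‖ ≤ B) → ∀ z ≠ N.p h,
    4 * c₂ * ‖t h.1‖ / ρ ≤ ‖z - N.p h‖ →
      ‖P z - ω.polarTerm h z‖ ≤ 4 * c₂ ^ 2 * ‖t h.1‖ * B / ‖z - N.p h‖ ^ 2

theorem isPrincipalPart_polarTerm (hρ : 0 < ρ) {h : EdgeEnd E} (ht : t h.1 = 0) :
    ω.IsPrincipalPart h (ω.polarTerm h) := by
  have hcore : N.core t h = {N.p h} := by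
    ext z
    simp only [core, ht, norm_zero, mul_zero, zero_div, norm_le_zero_iff, Set.mem_ofPred_eq,
      mem_singleton_iff]
    constructor
    · rintro ⟨hz, h0⟩
      rw [← param_coord hz, h0, param_zero]
    · rintro rfl
      exact ⟨N.p_mem h, N.coord_p h⟩
  have hpi := Complex.two_pi_I_ne_zero
  refine ⟨?_, ?_, ?_⟩
  · rw [hcore]
    intro z hz
    have hd : DifferentiableAt ℂ (fun z => 2 * Real.pi * Complex.I * (z - N.p h)) z := by fun_prop
    exact ((differentiableAt_const (ω.endPeriod h)).div hd
      (mul_ne_zero hpi (sub_ne_zero.2 hz))).differentiableWithinAt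
  · obtain ⟨g, hg, hfg⟩ := ω.simplePole_of_node hρ ht
    have hev := (eventually_nhdsWithin_iff.1 hfg).and
      (hg.eventually_analyticAt.and ((isOpen_disk h).mem_nhds (N.p_mem h)))
    obtain ⟨D, hD, hDo, hpD⟩ := eventually_nhds_iff.1 hev
    refine ⟨D, g, hDo, by rw [hcore]; simpa using hpD, fun z hz => (hD z hz).2.2,
      fun z hz => (hD z hz).2.1.differentiableAt.differentiableWithinAt, ?_⟩
    rintro z ⟨hz, hzc⟩
    rw [hcore] at hzc
    rw [(hD z hz).1 hzc, polarTerm, div_div]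
  · intro B _ z _ _
    simp [ht]

/-- Laurent splitting writes `ω/dz` as this integral minus a Cauchy integral over a larger curve,
which is holomorphic inside it. For the bound, `1/(z - p)` replaces the kernel and integrates to the
polar term. -/
theorem isPrincipalPart_curveCauchy (hρ : 0 < ρ) (hc₂ : 0 < c₂) {h : EdgeEnd E} (ht : t h.1 ≠ 0)
    (htρ : ∀ e, ‖t e‖ < ρ ^ 2) (hth : ‖t h.1‖ < ρ ^ 2 / 2) :
    ω.IsPrincipalPart h
      (curveCauchy (ω.localCoeff h) (N.param h) (2 * ‖t h.1‖ / ρ)) := by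
  -- With this radius, `|t / u| = ρ / 2` on the curve, whatever the size of `t`.
  set s := 2 * ‖t h.1‖ / ρ with hsdef
  have htpos : 0 < ‖t h.1‖ := norm_pos_iff.2 ht
  have hs0 : 0 < s := by positivity
  have hsρ : s < ρ := two_mul_norm_div_lt hρ hth
  have hts : ‖t h.1‖ / ρ < s := by rw [hsdef]; gcongr; linarith
  have hφ : ∀ r, s ≤ r → r < ρ → ContinuousOn (ω.localCoeff h) (Metric.sphere 0 r) :=
    fun r h1 h2 => (ω.differentiableOn_localCoeff h).continuousOn.mono fun u hu => by
      rw [mem_sphere_zero_iff_norm] at hu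
      exact ⟨by rw [hu]; linarith, by rwa [hu]⟩
  have hσ : ∀ r < ρ, ContinuousOn (N.param h) (Metric.sphere 0 r) := fun r hr =>
    (differentiableOn_param h).continuousOn.mono
      (Metric.sphere_subset_closedBall.trans (Metric.closedBall_subset_ball hr))
  refine ⟨?_, ?_, ?_⟩
  · intro z hz
    refine (curveCauchy_differentiableAt hs0.le (hφ s le_rfl hsρ) (hσ s hsρ)
      ?_).differentiableWithinAt
    rintro ⟨u, hu, rfl⟩
    rw [mem_sphere_zero_iff_norm] at hu
    have hu' : ‖u‖ < ρ := by rwa [hu]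
    exact hz ⟨param_mem_disk hu', by rw [coord_param hu', hu]⟩
  · set R := (s + ρ) / 2 with hR
    have hsR : s < R := by linarith
    have hRρ : R < ρ := by linarith
    refine ⟨{z | z ∈ N.disk h ∧ ‖N.coord h z‖ < R},
      fun z => -curveCauchy (ω.localCoeff h) (N.param h) R z, isOpen_coord_lt h R,
      fun z hz => ⟨hz.1, hz.2.trans_lt hsR⟩, fun z hz => hz.1, ?_, ?_⟩
    · intro z hz
      refine (curveCauchy_differentiableAt (hs0.trans hsR).le (hφ R hsR.le hRρ) (hσ R hRρ)
        ?_).neg.differentiableWithinAt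
      rintro ⟨u, hu, rfl⟩
      rw [mem_sphere_zero_iff_norm] at hu
      have hu' : ‖u‖ < ρ := by rwa [hu]
      have := hz.2
      rw [coord_param hu', hu] at this
      exact this.false
    · rintro z ⟨⟨hz, hzR⟩, hzc⟩
      have hsz : s < ‖N.coord h z‖ := not_le.1 fun hle => hzc ⟨hz, hle⟩
      have := laurent_splitting (differentiableOn_param (N := N) h) (injOn_param h)
        (fun u hu => deriv_param_ne_zero h hu) (ω.differentiableOn_atEnd_param h)
        hs0 hts hsz hzR hRρ
      rw [param_coord hz] at this
      rw [this]
      exact sub_eq_add_neg _ _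
  · intro B hB z hzp hz
    -- The curve stays within `c₂ * s` of `p`, so `z` is at least half as far from the curve as from
    -- `p`.
    have hz' : 2 * (c₂ * s) ≤ ‖z - N.p h‖ := by
      refine le_trans (le_of_eq ?_) hz
      rw [hsdef]; ring
    have hzp' : z - N.p h ≠ 0 := sub_ne_zero.2 hzp
    have hpi := Complex.two_pi_I_ne_zero
    have hdist : ∀ u : ℂ, ‖u‖ = s → ‖z - N.p h‖ / 2 ≤ ‖z - N.param h u‖ := by
      intro u hu
      have h1 := norm_param_sub_le (N := N) (h := h) (u := u) (by rwa [hu])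
      rw [hu] at h1
      have h2 := norm_sub_le_norm_sub_add_norm_sub z (N.param h u) (N.p h)
      linarith
    have hzpos : 0 < ‖z - N.p h‖ := norm_pos_iff.2 hzp'
    have hne : ∀ u : ℂ, ‖u‖ = s → z - N.param h u ≠ 0 := fun u hu =>
      norm_pos_iff.1 (lt_of_lt_of_le (by positivity) (hdist u hu))
    have hi1 : CircleIntegrable (fun u => ω.localCoeff h u / (z - N.param h u)) 0 s :=
      ((hφ s le_rfl hsρ).div (continuousOn_const.sub (hσ s hsρ)) fun u hu =>
        hne u (mem_sphere_zero_iff_norm.1 hu)).circleIntegrable hs0.le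
    have hi2 : CircleIntegrable (fun u => (z - N.p h)⁻¹ * ω.localCoeff h u) 0 s :=
      (continuousOn_const.mul (hφ s le_rfl hsρ)).circleIntegrable hs0.le
    have hpol : ω.polarTerm h z =
        (2 * Real.pi * Complex.I : ℂ)⁻¹ * ((z - N.p h)⁻¹ * ω.endPeriod h) := by
      rw [polarTerm, div_eq_mul_inv, mul_inv]; ring
    have hrep : curveCauchy (ω.localCoeff h) (N.param h) s z - ω.polarTerm h z =
        (2 * Real.pi * Complex.I : ℂ)⁻¹ • ∮ u in C(0, s),
          (ω.localCoeff h u / (z - N.param h u) - (z - N.p h)⁻¹ * ω.localCoeff h u) := by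
      rw [circleIntegral.integral_sub hi1 hi2, circleIntegral.integral_const_mul,
        ω.circleIntegral_localCoeff hρ htρ ht hts hsρ, curveCauchy, hpol, smul_eq_mul,
        mul_sub]
    rw [hrep]
    have hB0 : 0 ≤ B := (norm_nonneg _).trans (hB (ρ / 2 : ℝ) (by
      rw [Complex.norm_real, Real.norm_of_nonneg (by positivity)]))
    -- The factors bound in turn `ω/dz` and the derivative of the parametrization at the opposite
    -- end, the derivative of `t / u`, the difference `σ(u) - p`, and the two denominators.
    refine (circleIntegral.norm_two_pi_i_inv_smul_integral_le_of_norm_le_const (C :=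
      B * (2 * c₂) * (‖t h.1‖ / s ^ 2) * (c₂ * s) / (‖z - N.p h‖ / 2 * ‖z - N.p h‖)) hs0.le
      ?_).trans (le_of_eq ?_)
    · intro u hu
      rw [mem_sphere_zero_iff_norm] at hu
      have huρ : ‖u‖ < ρ := by rwa [hu]
      have htu : ‖t h.1 / u‖ = ρ / 2 := by
        rw [norm_div, hu, hsdef]; field_simp
      have hsplit : ω.localCoeff h u / (z - N.param h u) - (z - N.p h)⁻¹ * ω.localCoeff h u =
          ω.localCoeff h u * (N.param h u - N.p h) / ((z - N.param h u) * (z - N.p h)) := by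
        have := hne u hu
        field_simp
        ring
      rw [hsplit, norm_div, norm_mul, norm_mul, ω.localCoeff_flip_eq hρ ht huρ (by rwa [hu]),
        norm_mul, localCoeff, norm_mul, norm_div, norm_neg, norm_pow, hu]
      have h1 := hB _ htu
      have h2 := norm_deriv_param_le (N := N) (h := h.flip) hρ hc₂ htu
      have h3 := norm_param_sub_le (N := N) (h := h) huρ
      have h4 := hdist u hu
      rw [hu] at h3
      gcongr
    · rw [hsdef]
      field_simp
      ring

theorem exists_isPrincipalPart (hρ : 0 < ρ) (hc₂ : 0 < c₂) (htρ : ∀ e, ‖t e‖ < ρ ^ 2 / 2)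
    (h : EdgeEnd E) : ∃ P, ω.IsPrincipalPart h P := by
  by_cases ht : t h.1 = 0
  · exact ⟨_, ω.isPrincipalPart_polarTerm hρ ht⟩
  · refine ⟨_, ω.isPrincipalPart_curveCauchy hρ hc₂ ht (fun e => (htρ e).trans ?_) (htρ h.1)⟩
    have : 0 < ρ ^ 2 := by positivity
    linarith

end RegularDifferential

/-! ### Decomposition into principal parts by Liouville's theorem -/

/-- A function that extends holomorphically across finitely many separated closed sets has an
entire extension. -/
theorem exists_entire_extension {ι : Type*} (S : Finset ι) {K D : ι → Set ℂ} {Φ : ℂ → ℂ}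
    {q : ι → ℂ → ℂ} (hK : ∀ i ∈ S, IsClosed (K i)) (hD : ∀ i ∈ S, IsOpen (D i))
    (hKD : ∀ i ∈ S, K i ⊆ D i) (hdisj : ∀ i ∈ S, ∀ j ∈ S, i ≠ j → Disjoint (D i) (D j))
    (hΦ : DifferentiableOn ℂ Φ {z | ∀ i ∈ S, z ∉ K i})
    (hq : ∀ i ∈ S, DifferentiableOn ℂ (q i) (D i))
    (hΦq : ∀ i ∈ S, ∀ z ∈ D i \ K i, Φ z = q i z) :
    ∃ Ψ : ℂ → ℂ, Differentiable ℂ Ψ ∧ ∀ z, (∀ i ∈ S, z ∉ K i) → Ψ z = Φ z := by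
  classical
  set Ψ : ℂ → ℂ := fun z => if H : ∃ i ∈ S, z ∈ D i then q H.choose z else Φ z with hΨ
  have hin : ∀ i ∈ S, ∀ z ∈ D i, Ψ z = q i z := by
    intro i hi z hz
    have H : ∃ i ∈ S, z ∈ D i := ⟨i, hi, hz⟩
    have hch := H.choose_spec
    have : H.choose = i := by
      by_contra hne
      exact (hdisj _ hch.1 i hi hne).notMem_of_mem_left hch.2 hz
    simp only [hΨ, dif_pos H, this]
  have hout : ∀ z, (∀ i ∈ S, z ∉ K i) → Ψ z = Φ z := by
    intro z hz
    by_cases H : ∃ i ∈ S, z ∈ D i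
    · obtain ⟨i, hi, hzi⟩ := H
      rw [hin i hi z hzi, hΦq i hi z ⟨hzi, hz i hi⟩]
    · simp only [hΨ, dif_neg H]
  refine ⟨Ψ, fun z => ?_, hout⟩
  by_cases H : ∃ i ∈ S, z ∈ D i
  · obtain ⟨i, hi, hzi⟩ := H
    have hn := (hD i hi).mem_nhds hzi
    refine ((hq i hi).differentiableAt hn).congr_of_eventuallyEq ?_
    filter_upwards [hn] with w hw using hin i hi w hw
  · have hopen : IsOpen {z | ∀ i ∈ S, z ∉ K i} := by
      have : {z | ∀ i ∈ S, z ∉ K i} = ⋂ i ∈ S, (K i)ᶜ := by ext w; simp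
      rw [this]
      exact isOpen_biInter_finset fun i hi => (hK i hi).isOpen_compl
    have hn := hopen.mem_nhds (x := z) fun i hi hzi => H ⟨i, hi, hKD i hi hzi⟩
    refine (hΦ.differentiableAt hn).congr_of_eventuallyEq ?_
    filter_upwards [hn] with w hw using hout w hw

theorem HolomorphicAtInfty.tendsto_zero {f : ℂ → ℂ} (hf : HolomorphicAtInfty f) :
    Tendsto f (cocompact ℂ) (𝓝 0) := by
  obtain ⟨g, hg, hgf⟩ := hf
  have h1 : Tendsto (fun w : ℂ => f w⁻¹) (𝓝[≠] 0) (𝓝 0) := by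
    have h2 : Tendsto (fun w : ℂ => -g w * w ^ 2) (𝓝[≠] 0) (𝓝 0) := by
      have : ContinuousAt (fun w : ℂ => -g w * w ^ 2) 0 :=
        hg.continuousAt.neg.mul (by fun_prop)
      have h3 := this.tendsto
      simp only [ne_eq, OfNat.ofNat_ne_zero, not_false_eq_true, zero_pow, mul_zero] at h3
      exact h3.mono_left nhdsWithin_le_nhds
    refine h2.congr' ?_
    filter_upwards [hgf, self_mem_nhdsWithin] with w hw hw0
    have : w ≠ 0 := hw0
    rw [hw]
    field_simp
  rw [← Metric.cobounded_eq_cocompact]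
  refine (h1.comp tendsto_inv₀_cobounded').congr fun z => ?_
  simp

namespace RegularDifferential

open AdmissibleCoordinates

variable {G : OrientedMultigraph V E} {ρ c₁ c₂ : ℝ}
  {N : AdmissibleCoordinates G ρ c₁ c₂} {t : E → ℂ}

variable (ω : RegularDifferential N t)

/-- The supremum of `|ω/dz|` on the circle `|z_e^±| = ρ / 2`. -/
def circleSup (h : EdgeEnd E) : ℝ :=
  sSup ((fun u => ‖ω.atEnd h (N.param h u)‖) '' Metric.sphere 0 (ρ / 2))

theorem norm_le_circleSup (hρ : 0 < ρ) {h : EdgeEnd E} (ht : ‖t h.1‖ < ρ ^ 2 / 2) {u : ℂ}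
    (hu : ‖u‖ = ρ / 2) : ‖ω.atEnd h (N.param h u)‖ ≤ ω.circleSup h := by
  refine le_csSup (IsCompact.bddAbove ?_) (mem_image_of_mem _ (by simpa using hu))
  refine (isCompact_sphere _ _).image_of_continuousOn (ContinuousOn.norm ?_)
  refine (ω.differentiableOn_atEnd_param h).continuousOn.mono fun w hw => ?_
  rw [mem_sphere_zero_iff_norm] at hw
  refine ⟨?_, by rw [hw]; linarith⟩
  rw [hw, div_lt_iff₀ hρ]
  nlinarith

theorem circleSup_le (hρ : 0 < ρ) {h : EdgeEnd E} {B : ℝ}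
    (hB : ∀ u : ℂ, ‖u‖ = ρ / 2 → ‖ω.atEnd h (N.param h u)‖ ≤ B) : ω.circleSup h ≤ B := by
  refine csSup_le (Set.Nonempty.image _ (NormedSpace.sphere_nonempty.2 (by positivity))) ?_
  rintro _ ⟨u, hu, rfl⟩
  exact hB u (by simpa using hu)

theorem circleSup_nonneg (h : EdgeEnd E) : 0 ≤ ω.circleSup h := by
  refine Real.sSup_nonneg ?_
  rintro _ ⟨u, -, rfl⟩
  exact norm_nonneg _

variable {ω} {P : EdgeEnd E → ℂ → ℂ}

theorem norm_polarTerm_le {h : EdgeEnd E} {a d : ℝ} (ha : ‖ω.endPeriod h‖ ≤ a) (hd : 0 < d) {z : ℂ}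
    (hz : d ≤ ‖z - N.p h‖) : ‖ω.polarTerm h z‖ ≤ a / d := by
  have h2 : ‖(2 * Real.pi * Complex.I : ℂ)‖ = 2 * Real.pi := by
    simp [abs_of_pos Real.pi_pos]
  have ha0 : 0 ≤ a := (norm_nonneg _).trans ha
  rw [polarTerm, norm_div, norm_mul, h2]
  have : d ≤ 2 * Real.pi * ‖z - N.p h‖ := by
    nlinarith [Real.pi_gt_three, norm_nonneg (z - N.p h)]
  gcongr

theorem IsPrincipalPart.norm_le (hρ : 0 < ρ) {h : EdgeEnd E} {Q : ℂ → ℂ}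
    (hQ : ω.IsPrincipalPart h Q) (ht : ‖t h.1‖ < ρ ^ 2 / 2) {a d : ℝ} (ha : ‖ω.endPeriod h‖ ≤ a)
    (hd : 0 < d) (htd : 4 * c₂ * ‖t h.1‖ / ρ ≤ d) {z : ℂ} (hz : d ≤ ‖z - N.p h‖) :
    ‖Q z‖ ≤ a / d + 4 * c₂ ^ 2 / d ^ 2 * ‖t h.1‖ * ω.circleSup h.flip := by
  have hzp : z ≠ N.p h := sub_ne_zero.1 (norm_pos_iff.1 (hd.trans_le hz))
  have h1 := hQ.bound (ω.circleSup h.flip)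
    (fun u hu => ω.norm_le_circleSup hρ (h := h.flip) ht hu) z hzp (htd.trans hz)
  have h2 := norm_polarTerm_le ha hd hz
  have h3 : 4 * c₂ ^ 2 * ‖t h.1‖ * ω.circleSup h.flip / ‖z - N.p h‖ ^ 2 ≤
      4 * c₂ ^ 2 * ‖t h.1‖ * ω.circleSup h.flip / d ^ 2 := by
    have := ω.circleSup_nonneg h.flip
    gcongr
  have h4 := norm_le_norm_add_norm_sub (ω.polarTerm h z) (Q z)
  rw [norm_sub_rev] at h4
  calc ‖Q z‖ ≤ a / d + 4 * c₂ ^ 2 * ‖t h.1‖ * ω.circleSup h.flip / d ^ 2 := by linarith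
    _ = _ := by ring

/-- The bound of `norm_le` with `d = ‖z - p‖` itself. -/
theorem IsPrincipalPart.tendsto_zero (hρ : 0 < ρ) {h : EdgeEnd E} {Q : ℂ → ℂ}
    (hQ : ω.IsPrincipalPart h Q) (ht : ‖t h.1‖ < ρ ^ 2 / 2) :
    Tendsto Q (cocompact ℂ) (𝓝 0) := by
  have hnorm : Tendsto (fun z : ℂ => ‖z - N.p h‖) (cocompact ℂ) atTop := by
    refine tendsto_atTop_mono (fun z => norm_sub_norm_le z (N.p h)) ?_
    exact tendsto_atTop_add_const_right _ _ tendsto_norm_cocompact_atTop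
  have hlim : Tendsto (fun d : ℝ => ‖ω.endPeriod h‖ / d +
      4 * c₂ ^ 2 / d ^ 2 * ‖t h.1‖ * ω.circleSup h.flip) atTop (𝓝 0) := by
    have h1 : Tendsto (fun d : ℝ => ‖ω.endPeriod h‖ / d) atTop (𝓝 0) :=
      tendsto_const_nhds.div_atTop tendsto_id
    have h2 : Tendsto (fun d : ℝ => 4 * c₂ ^ 2 / d ^ 2) atTop (𝓝 0) :=
      tendsto_const_nhds.div_atTop (tendsto_pow_atTop two_ne_zero)
    simpa using h1.add ((h2.mul_const ‖t h.1‖).mul_const (ω.circleSup h.flip))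
  refine squeeze_zero_norm' ?_ (hlim.comp hnorm)
  filter_upwards [hnorm.eventually_gt_atTop 0,
    hnorm.eventually_ge_atTop (4 * c₂ * ‖t h.1‖ / ρ)] with z h0 h1
  exact hQ.norm_le hρ ht le_rfl h0 h1 le_rfl

/-- A regular differential is the sum of its principal parts on each sphere. -/
theorem eq_sum_principalPart (hρ : 0 < ρ) (ht : ∀ e, ‖t e‖ < ρ ^ 2 / 2)
    (hP : ∀ h, ω.IsPrincipalPart h (P h)) {v : V} {S : Finset (EdgeEnd E)}
    (hS : ∀ h, h ∈ S ↔ G.vertexOf h = v) {z : ℂ} (hz : ∀ h ∈ S, z ∉ N.core t h) :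
    ω.toFun v z = ∑ h ∈ S, P h z := by
  classical
  choose D q hDo hcD hDd hq hfq using fun h => (hP h).ext
  have hdisj : ∀ i ∈ S, ∀ j ∈ S, i ≠ j → Disjoint (N.disk i) (N.disk j) := fun i hi j hj hne =>
    N.disjoint i j hne (((hS i).1 hi).trans ((hS j).1 hj).symm)
  -- Near the core of `h` the singularities of `ω` and `P h` cancel, leaving `q h`; the other
  -- principal parts are holomorphic there because the disks are disjoint.
  obtain ⟨Ψ, hΨ, hΨe⟩ := exists_entire_extension S (K := fun h => N.core t h) (D := D)
    (Φ := fun z => ω.toFun v z - ∑ h ∈ S, P h z)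
    (q := fun h z => q h z - ∑ h' ∈ S.erase h, P h' z)
    (fun h _ => isClosed_core hρ (ht h.1)) (fun h _ => hDo h) (fun h _ => hcD h)
    (fun i hi j hj hne => (hdisj i hi j hj hne).mono (hDd i) (hDd j))
    (by
      refine DifferentiableOn.sub ((ω.holo v).mono fun w hw h hv hr => ?_) ?_
      · exact hw h ((hS h).2 hv) (removed_subset_core hρ hr)
      · exact DifferentiableOn.fun_sum fun h hh => (hP h).diff.mono fun w hw => hw h hh)
    (by
      intro i hi
      refine (hq i).sub (DifferentiableOn.fun_sum fun j hj => (hP j).diff.mono fun w hw hwc => ?_)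
      rw [Finset.mem_erase] at hj
      exact (hdisj j hj.2 i hi hj.1).notMem_of_mem_left hwc.1 (hDd i hw))
    (by
      intro i hi w hw
      have := hfq i w hw
      rw [atEnd, (hS i).1 hi] at this
      rw [this, ← Finset.add_sum_erase S (fun h => P h w) hi]
      ring)
  have hev : ∀ᶠ w in cocompact ℂ, ∀ h ∈ S, w ∉ N.core t h := by
    rw [Finset.eventually_all]
    intro h _
    have hc : IsCompact (N.core t h) := by
      have := isCompact_param_image (N := N) (h := h) (two_mul_norm_div_lt hρ (ht h.1))
      convert this using 1
      ext w
      exact (mem_param_image (two_mul_norm_div_lt hρ (ht h.1))).symm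
    exact hc.compl_mem_cocompact
  have hlim : Tendsto Ψ (cocompact ℂ) (𝓝 0) := by
    have h1 : Tendsto (fun z => ω.toFun v z - ∑ h ∈ S, P h z) (cocompact ℂ) (𝓝 0) := by
      have := (ω.holo_infty v).tendsto_zero.sub
        (tendsto_finsetSum S fun h _ => (hP h).tendsto_zero hρ (ht h.1))
      simpa using this
    refine h1.congr' ?_
    filter_upwards [hev] with w hw using (hΨe w hw).symm
  have h0 := hΨ.apply_eq_of_tendsto_cocompact z hlim
  rw [hΨe z hz] at h0
  exact sub_eq_zero.1 h0

theorem atEnd_eq_principalPart_add (hρ : 0 < ρ) (ht : ∀ e, ‖t e‖ < ρ ^ 2 / 2)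
    (hP : ∀ h, ω.IsPrincipalPart h (P h)) [DecidableEq (EdgeEnd E)] {h : EdgeEnd E}
    {S : Finset (EdgeEnd E)} (hS : ∀ h', h' ∈ S ↔ G.vertexOf h' = G.vertexOf h) {z : ℂ}
    (hz : z ∈ closure (N.disk h)) (hzc : z ∉ N.core t h) :
    ω.atEnd h z = P h z + ∑ h' ∈ S.erase h, P h' z := by
  rw [Finset.add_sum_erase S (fun h => P h z) ((hS h).2 rfl)]
  refine eq_sum_principalPart hρ ht hP hS fun h' hh' hzc' => ?_
  rcases eq_or_ne h h' with rfl | hne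
  · exact hzc hzc'
  · exact notMem_disk_of_mem_closure hne ((hS h').1 hh').symm hz hzc'.1

/-! ### Estimates on the fixed circles and in the necks -/

/-- An a priori bound for `ω` on the circle `|z_e^±| = ρ / 2`, by the maximum principle. -/
theorem circleSup_le_of_memHInfty (hρ : 0 < ρ) (hc₁ : 0 < c₁) (hc₂ : 0 < c₂) {k : ℕ}
    (hG : G.DegreeLE k) (ht : ∀ e, ‖t e‖ < ρ ^ 2 / 4) {d : ℝ} (hd : d = c₁ * ρ / 2)
    (htd : ∀ e, 4 * c₂ * ‖t e‖ / ρ ≤ d)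
    (hP : ∀ h, ω.IsPrincipalPart h (P h)) {a : ℝ} (ha : ∀ h, ‖ω.endPeriod h‖ ≤ a)
    {ε M : ℝ} (hε : ε ≤ ρ * c₁)
    (hM : ∀ v, ∀ z ∈ N.Omega ε v ∩ N.sphereDomain t v, ‖ω.toFun v z‖ ≤ M) (h : EdgeEnd E) :
    ω.circleSup h ≤ M + 2 * (a / d + 4 * c₂ ^ 2 / d ^ 2 * ‖t h.1‖ * ω.circleSup h.flip) := by
  classical
  have hρ2 : 0 < ρ ^ 2 := by positivity
  have ht2 : ∀ e, ‖t e‖ < ρ ^ 2 / 2 := fun e => by linarith [ht e]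
  have hd0 : 0 < d := by rw [hd]; positivity
  obtain ⟨S, hS, -⟩ := hG.exists_finset (G.vertexOf h)
  set b := a / d + 4 * c₂ ^ 2 / d ^ 2 * ‖t h.1‖ * ω.circleSup h.flip with hb
  have hPle : ∀ z, (z ∈ N.disk h → ρ / 2 ≤ ‖N.coord h z‖) → ‖P h z‖ ≤ b := by
    intro z hz
    refine (hP h).norm_le hρ (ht2 h.1) (ha h) hd0 (htd h.1) ?_
    rw [hd, mul_div_assoc]
    exact norm_sub_ge_of_forall_coord_ge hc₁ (by linarith) hz
  have hcore : ∀ z, (z ∈ N.disk h → ρ / 2 ≤ ‖N.coord h z‖) → z ∉ N.core t h := by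
    intro z hz hzc
    have h1 := (hz hzc.1).trans hzc.2
    rw [le_div_iff₀ hρ] at h1
    nlinarith [ht h.1]
  -- The maximum principle is applied to `ω` minus its own principal part, since this extends over
  -- the whole disk, including the removed part.
  have hdiff : DiffContOnCl ℂ (fun z => ∑ h' ∈ S.erase h, P h' z) (N.disk h) := by
    refine DifferentiableOn.diffContOnCl (DifferentiableOn.fun_sum fun h' hh' =>
      (hP h').diff.mono fun w hw hwc => ?_)
    rw [Finset.mem_erase] at hh'
    exact notMem_disk_of_mem_closure hh'.1.symm ((hS h').1 hh'.2).symm hw hwc.1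
  have hbdd : Bornology.IsBounded (N.disk h) := by
    refine (Metric.isBounded_closedBall (x := N.p h) (r := c₂ * ρ)).subset fun z hz => ?_
    rw [mem_closedBall_iff_norm]
    exact (N.upper h z hz).trans (by gcongr; exact (norm_coord_lt hz).le)
  have hfr : ∀ z ∈ frontier (N.disk h), ‖∑ h' ∈ S.erase h, P h' z‖ ≤ M + b := by
    intro z hz
    have hzcl : z ∈ closure (N.disk h) := hz.1
    have hzn : z ∉ N.disk h := by
      have := hz.2
      rwa [(isOpen_disk h).interior_eq] at this
    have h1 := atEnd_eq_principalPart_add hρ ht2 hP hS hzcl (hcore z fun H => absurd H hzn)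
    have h2 := hPle z fun H => absurd H hzn
    have h3 : ‖ω.atEnd h z‖ ≤ M := by
      refine hM _ z ⟨fun h' hv hball => ?_,
        mem_sphereDomain_of_mem_closure hzcl fun H => absurd H hzn⟩
      -- Boundary points lie in the region where `M` applies: since `ε ≤ ρ * c₁`, each ball of
      -- radius `ε` is contained in the coordinate disk of its end.
      have hzd : z ∈ N.disk h' := mem_disk_of_norm_sub_lt hc₁ (by
        rw [mem_ball_iff_norm] at hball
        linarith)
      rcases eq_or_ne h h' with rfl | hne
      · exact hzn hzd
      · exact notMem_disk_of_mem_closure hne hv.symm hzcl hzd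
    rw [← sub_eq_iff_eq_add'] at h1
    rw [← h1]
    exact (norm_sub_le _ _).trans (add_le_add h3 h2)
  refine ω.circleSup_le hρ fun u hu => ?_
  have hu' : ‖u‖ < ρ := by linarith
  have hz := param_mem_disk (N := N) (h := h) hu'
  have hco : N.param h u ∈ N.disk h → ρ / 2 ≤ ‖N.coord h (N.param h u)‖ := fun _ => by
    rw [coord_param hu', hu]
  rw [atEnd_eq_principalPart_add hρ ht2 hP hS (subset_closure hz) (hcore _ hco)]
  have h1 := hPle _ hco
  have h2 := Complex.norm_le_of_forall_mem_frontier_norm_le hbdd hdiff hfr (subset_closure hz)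
  linarith [norm_add_le (P h (N.param h u)) (∑ h' ∈ S.erase h, P h' (N.param h u))]

/-- The bound of `ω` on the circles `|z_e^±| = ρ / 2` by its periods. -/
theorem circleSup_le_of_period_le (hρ : 0 < ρ) (hc₁ : 0 < c₁) (hc₂ : 0 < c₂) {k : ℕ}
    (hG : G.DegreeLE k) (ht : ∀ e, ‖t e‖ < ρ ^ 2 / 4) {d : ℝ} (hd : d = c₁ * ρ / 2)
    (htd : ∀ e, 4 * c₂ * ‖t e‖ / ρ ≤ d)
    (htk : ∀ e, 4 * c₂ ^ 2 / d ^ 2 * ‖t e‖ ≤ 1 / (4 * (k + 1)))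
    (hP : ∀ h, ω.IsPrincipalPart h (P h)) {a : ℝ} (ha : ∀ h, ‖ω.endPeriod h‖ ≤ a)
    {ε : ℝ} (hε : ε ≤ ρ * c₁) (hω : ω.MemHInfty ε) (h : EdgeEnd E) :
    ω.circleSup h ≤ 4 * k * (a / d) := by
  classical
  obtain ⟨M, hM⟩ := hω
  have hρ2 : 0 < ρ ^ 2 := by positivity
  have ht2 : ∀ e, ‖t e‖ < ρ ^ 2 / 2 := fun e => by linarith [ht e]
  have hd0 : 0 < d := by rw [hd]; positivity
  have hk0 : (0 : ℝ) ≤ k := Nat.cast_nonneg k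
  have ha0 : 0 ≤ a := (norm_nonneg _).trans (ha h)
  have hle4 : ∀ e, 4 * c₂ ^ 2 / d ^ 2 * ‖t e‖ ≤ 1 / 4 := fun e =>
    (htk e).trans (one_div_le_one_div_of_le (by norm_num) (by linarith))
  have hstep : ∀ h, ω.circleSup h ≤ M + 2 * (a / d) + 1 / 2 * ω.circleSup h.flip := by
    intro h
    have h1 := circleSup_le_of_memHInfty hρ hc₁ hc₂ hG ht hd htd hP ha hε hM h
    have h2 := mul_le_mul_of_nonneg_right (hle4 h.1) (ω.circleSup_nonneg h.flip)
    linarith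
  -- Applying `hstep` at both ends of one edge gives `X ≤ K + (K + X / 2) / 2`, hence `X ≤ 2 K`
  -- uniformly. Only now can the supremum `A` be absorbed.
  have hbdd : BddAbove (range fun h => ω.circleSup h) := by
    refine ⟨2 * (M + 2 * (a / d)), ?_⟩
    rintro _ ⟨h, rfl⟩
    have h1 := hstep h
    have h2 := hstep h.flip
    rw [EdgeEnd.flip_flip] at h2
    simp only
    linarith
  set A := ⨆ h, ω.circleSup h with hA
  have hleA : ∀ h, ω.circleSup h ≤ A := fun h => le_ciSup hbdd h
  have hA0 : 0 ≤ A := (ω.circleSup_nonneg h).trans (hleA h)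
  have hbound : ∀ h, ω.circleSup h ≤ 2 * k * (a / d + 1 / (4 * (k + 1)) * A) := by
    intro h
    refine ω.circleSup_le hρ fun u hu => ?_
    have hu' : ‖u‖ < ρ := by linarith
    obtain ⟨S, hS, hcard⟩ := hG.exists_finset (G.vertexOf h)
    have hdisk := param_mem_disk (N := N) (h := h) hu'
    have hfar : ∀ h' ∈ S, N.param h u ∈ N.disk h' → ρ / 2 ≤ ‖N.coord h' (N.param h u)‖ := by
      intro h' hh' hz
      rcases eq_or_ne h h' with rfl | hne
      · rw [coord_param hu', hu]
      · exact absurd hz (notMem_disk_of_mem_closure hne ((hS h').1 hh').symm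
          (subset_closure hdisk))
    have hsum : ω.atEnd h (N.param h u) = ∑ h' ∈ S, P h' (N.param h u) := by
      refine eq_sum_principalPart hρ ht2 hP hS fun h' hh' hzc => ?_
      have h1 := (hfar h' hh' hzc.1).trans hzc.2
      rw [le_div_iff₀ hρ] at h1
      nlinarith [ht h'.1]
    rw [hsum]
    have hX : 0 ≤ a / d + 1 / (4 * (k + 1)) * A := by positivity
    refine (norm_sum_le_of_le S (f := fun h' => P h' (N.param h u))
      (n := fun _ => a / d + 1 / (4 * (k + 1)) * A) fun h' hh' => ?_).trans ?_
    · refine ((hP h').norm_le hρ (ht2 h'.1) (ha h') hd0 (htd h'.1) ?_).trans ?_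
      · rw [hd, mul_div_assoc]
        exact norm_sub_ge_of_forall_coord_ge hc₁ (by linarith) (hfar h' hh')
      · exact add_le_add_right (mul_le_mul (htk h'.1) (hleA _) (ω.circleSup_nonneg _)
          (by positivity)) _
    · rw [Finset.sum_const, nsmul_eq_mul]
      have : (S.card : ℝ) ≤ 2 * k := by exact_mod_cast hcard
      gcongr
  have : Nonempty (EdgeEnd E) := ⟨h⟩
  have hAle : A ≤ 2 * k * (a / d + 1 / (4 * (k + 1)) * A) := ciSup_le hbound
  -- Half of `A` is absorbed on the left, leaving `A ≤ 4 k a / d`.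
  have hhalf : 2 * k * (1 / (4 * (k + 1)) * A) ≤ 1 / 2 * A := by
    have : 2 * k * (1 / (4 * ((k : ℝ) + 1))) ≤ 1 / 2 := by
      rw [mul_one_div, div_le_div_iff₀ (by positivity) (by norm_num)]
      linarith
    nlinarith
  have := hleA h
  nlinarith

/-- The estimate of `ω` in the necks, in terms of a bound of the periods. -/
theorem norm_sub_polarTerm_le (hρ : 0 < ρ) (hc₁ : 0 < c₁) (hc₂ : 0 < c₂) {k : ℕ}
    (hG : G.DegreeLE k) (ht : ∀ e, ‖t e‖ < ρ ^ 2 / 4) {d : ℝ} (hd : d = c₁ * ρ / 2)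
    (htd : ∀ e, 4 * c₂ * ‖t e‖ / ρ ≤ d)
    (hts : ∀ e, ‖t e‖ ≤ (c₁ * ρ / (4 * c₂)) ^ 2)
    (htk : ∀ e, 4 * c₂ ^ 2 / d ^ 2 * ‖t e‖ ≤ 1 / (4 * (k + 1)))
    {a : ℝ} (ha : ∀ h, ‖ω.endPeriod h‖ ≤ a)
    {ε : ℝ} (hε : ε ≤ ρ * c₁) (hω : ω.MemHInfty ε) (h : EdgeEnd E) {z : ℂ}
    (hz : z ∈ N.neckAnnulus t h) :
    ‖ω.atEnd h z - ω.polarTerm h z‖ ≤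
      (4 * c₂ ^ 2 / c₁ ^ 2 * (4 * k / d) + 2 * k * (1 / d + k / d)) * a := by
  classical
  have hρ2 : 0 < ρ ^ 2 := by positivity
  have ht2 : ∀ e, ‖t e‖ < ρ ^ 2 / 2 := fun e => by linarith [ht e]
  have hd0 : 0 < d := by rw [hd]; positivity
  have ha0 : 0 ≤ a := (norm_nonneg _).trans (ha h)
  have hk0 : (0 : ℝ) ≤ k := Nat.cast_nonneg k
  choose P hP using fun h => ω.exists_isPrincipalPart hρ hc₂ ht2 h
  have hA := circleSup_le_of_period_le hρ hc₁ hc₂ hG ht hd htd htk hP ha hε hω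
  obtain ⟨hzcl, hzp, hzc⟩ := hz
  set x := √‖t h.1‖ with hx
  have hx0 : 0 ≤ x := Real.sqrt_nonneg _
  have hxx : x ^ 2 = ‖t h.1‖ := Real.sq_sqrt (norm_nonneg _)
  have hxρ : x < ρ / 2 := by
    rw [hx, Real.sqrt_lt' (by positivity)]
    linarith [ht h.1]
  have hxc : x ≤ c₁ * ρ / (4 * c₂) := by
    rw [hx, Real.sqrt_le_left (by positivity)]
    exact hts h.1
  have hdist : c₁ * x ≤ ‖z - N.p h‖ := norm_sub_ge_of_forall_coord_ge hc₁ (by linarith) hzc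
  -- Since `√|t| < ρ / 2`, the inner radius `√|t|` exceeds `2|t| / ρ` unless `t = 0`, when the core
  -- is the excluded point `p`.
  have hcore : z ∉ N.core t h := by
    rintro ⟨hzd, hle⟩
    have h1 := (hzc hzd).trans hle
    rw [le_div_iff₀ hρ, ← hxx] at h1
    have h2 : x = 0 := by nlinarith
    rw [← hxx, h2] at hle
    have h3 : N.coord h z = 0 := by simpa using hle
    rw [← param_coord hzd, h3, param_zero] at hzp
    exact hzp rfl
  obtain ⟨S, hS, hcard⟩ := hG.exists_finset (G.vertexOf h)
  have hfirst : ‖P h z - ω.polarTerm h z‖ ≤ 4 * c₂ ^ 2 / c₁ ^ 2 * (4 * k * (a / d)) := by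
    have hzpos : 0 < ‖z - N.p h‖ := norm_pos_iff.2 (sub_ne_zero.2 hzp)
    have h1 := (hP h).bound (4 * k * (a / d))
      (fun u hu => (ω.norm_le_circleSup hρ (h := h.flip) (ht2 h.1) hu).trans (hA _)) z hzp ?_
    · refine h1.trans ?_
      rw [div_le_iff₀ (by positivity)]
      -- This is where the radius `√|t|` matters: `|t| / |z - p|²` is at most `1 / c₁²`.
      have h2 : c₁ ^ 2 * ‖t h.1‖ ≤ ‖z - N.p h‖ ^ 2 := by
        rw [← hxx, ← mul_pow]
        gcongr
      have h3 : ‖t h.1‖ ≤ ‖z - N.p h‖ ^ 2 / c₁ ^ 2 := by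
        rw [le_div_iff₀ (by positivity)]; linarith
      calc 4 * c₂ ^ 2 * ‖t h.1‖ * (4 * k * (a / d))
          ≤ 4 * c₂ ^ 2 * (‖z - N.p h‖ ^ 2 / c₁ ^ 2) * (4 * k * (a / d)) := by gcongr
        _ = _ := by ring
    · refine le_trans ?_ hdist
      rw [div_le_iff₀ hρ, ← hxx]
      rw [le_div_iff₀ (by positivity)] at hxc
      nlinarith
  have hrest : ‖∑ h' ∈ S.erase h, P h' z‖ ≤ 2 * k * (a / d + k * (a / d)) := by
    refine (norm_sum_le_of_le (S.erase h) (f := fun h' => P h' z)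
      (n := fun _ => a / d + k * (a / d)) fun h' hh' => ?_).trans ?_
    · rw [Finset.mem_erase] at hh'
      refine ((hP h').norm_le hρ (ht2 h'.1) (ha h') hd0 (htd h'.1) ?_).trans ?_
      · rw [hd, mul_div_assoc]
        exact norm_sub_ge_of_forall_coord_ge hc₁ (by linarith) fun H =>
          absurd H (notMem_disk_of_mem_closure hh'.1.symm ((hS h').1 hh'.2).symm hzcl)
      · refine add_le_add_right ?_ _
        have h1 : 4 * c₂ ^ 2 / d ^ 2 * ‖t h'.1‖ ≤ 1 / 4 :=
          (htk h'.1).trans (one_div_le_one_div_of_le (by norm_num) (by linarith))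
        calc _ ≤ 1 / 4 * (4 * k * (a / d)) :=
              mul_le_mul h1 (hA _) (ω.circleSup_nonneg _) (by norm_num)
          _ = _ := by ring
    · rw [Finset.sum_const, nsmul_eq_mul]
      have h1 : ((S.erase h).card : ℝ) ≤ 2 * k := by
        exact_mod_cast (Finset.card_erase_le).trans hcard
      gcongr
  rw [atEnd_eq_principalPart_add hρ ht2 hP hS hzcl hcore, add_sub_right_comm]
  refine (norm_add_le _ _).trans ((add_le_add hfirst hrest).trans (le_of_eq ?_))
  ring

end RegularDifferential

end OpeningNodes

end

/-! ### Choice of the constants -/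

theorem proposition2 (ρ c₁ c₂ : ℝ) (hρ : 0 < ρ) (hc₁ : 0 < c₁) (hc₂ : 0 < c₂) (k : ℕ) :
    ∃ C : ℝ, 0 < C ∧ ∃ δ : ℝ, 0 < δ ∧
      ∀ (V E : Type*) (G : OpeningNodes.OrientedMultigraph V E), G.DegreeLE k →
      ∀ (N : OpeningNodes.AdmissibleCoordinates G ρ c₁ c₂)
        (t : E → ℂ), (∀ e, ‖t e‖ < ρ ^ 2) → (∀ e, ‖t e‖ ≤ δ) →
      ∀ (ε : ℝ), 0 < ε → ε ≤ ρ * c₁ →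
      ∀ (α : lp (fun _ : E => ℂ) ⊤) (ω : OpeningNodes.RegularDifferential N t),
        ω.MemHInfty ε → (∀ e, ω.period e = α e) →
      ∀ e : E,
        (∀ z ∈ N.neckAnnulus t (e, true),
          ‖ω.toFun (G.tgt e) z - α e / (2 * Real.pi * Complex.I * (z - N.p (e, true)))‖
            ≤ C * ‖α‖) ∧
        (∀ z ∈ N.neckAnnulus t (e, false),
          ‖ω.toFun (G.src e) z + α e / (2 * Real.pi * Complex.I * (z - N.p (e, false)))‖
            ≤ C * ‖α‖) := by
  -- A lower bound for the distance to `p` of points outside `|z_e| < ρ / 2`.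
  obtain ⟨d, hd⟩ : ∃ d, d = c₁ * ρ / 2 := ⟨_, rfl⟩
  have hd0 : 0 < d := by rw [hd]; positivity
  -- The `+ 1` keeps `C` positive when `k = 0`. The four bounds on `|t|` keep cores well inside the
  -- disks, make the principal-part estimate valid at distance `d` and then at distance `c₁ √|t|`,
  -- and allow the absorption of `A`.
  refine ⟨4 * c₂ ^ 2 / c₁ ^ 2 * (4 * k / d) + 2 * k * (1 / d + k / d) + 1, by positivity,
    min (min (ρ ^ 2 / 8) (d * ρ / (4 * c₂)))
      (min ((c₁ * ρ / (4 * c₂)) ^ 2) (1 / (4 * (k + 1)) / (4 * c₂ ^ 2 / d ^ 2))), by positivity, ?_⟩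
  intro V E G hG N t _ htδ ε _ hε α ω hω hα e
  simp only [le_min_iff] at htδ
  have hρ2 : 0 < ρ ^ 2 := by positivity
  have ha : ∀ h, ‖ω.endPeriod h‖ ≤ ‖α‖ := by
    intro h
    have h1 : ‖α h.1‖ ≤ ‖α‖ := lp.norm_apply_le_norm ENNReal.top_ne_zero α h.1
    rw [OpeningNodes.RegularDifferential.endPeriod, hα]
    split_ifs
    · exact h1
    · rwa [norm_neg]
  have key := fun h z hz => ω.norm_sub_polarTerm_le hρ hc₁ hc₂ hG
    (fun e => by linarith [(htδ e).1.1]) hd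
    (fun e => by
      have := (htδ e).1.2
      rw [le_div_iff₀ (by positivity)] at this
      rw [div_le_iff₀ hρ]
      linarith)
    (fun e => (htδ e).2.1)
    (fun e => by
      have := (htδ e).2.2
      rw [le_div_iff₀ (by positivity)] at this
      linarith)
    ha hε hω h (z := z) hz
  have hmono : (4 * c₂ ^ 2 / c₁ ^ 2 * (4 * k / d) + 2 * k * (1 / d + k / d)) * ‖α‖ ≤
      (4 * c₂ ^ 2 / c₁ ^ 2 * (4 * k / d) + 2 * k * (1 / d + k / d) + 1) * ‖α‖ :=
    mul_le_mul_of_nonneg_right (by linarith) (norm_nonneg _)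
  refine ⟨fun z hz => le_trans (le_of_eq ?_) ((key (e, true) z hz).trans hmono),
    fun z hz => le_trans (le_of_eq ?_) ((key (e, false) z hz).trans hmono)⟩
  · rw [← hα]; rfl
  · rw [← hα, ← sub_neg_eq_add, ← neg_div]; rfl
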